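/- **Definitions.** *Alternating sign matrices.* Let $\mathsf{ASM}(n)$ be the set of $n\times n$ matrices $A=(a_{ij})$ with entries in $\{-1,0,1\}$ such that the nonzero entries of each row and column alternate in sign and each row and column sums to $1$. Put $r_A(i,j)=\sum_{k\le i,\,l\le j}a_{kl}$ and order $\mathsf{ASM}(n)$ by $A\le B$ iff $r_A(i,j)\ge r_B(i,j)$ for all $i,j$. A permutation $w\in\mathcal S_n$ is identified with the matrix having ones in the positions $(i,w(i))$; $\ell(w)$ is its number of inversions. For $A\in\mathsf{ASM}(n)$ let $\deg(A)=\min\{\ell(w):w\in\mathcal S_n,\ w\ge A\}$, let ${\tt Perm}(A)$ be the set of minimal elements of $\{w\in\mathcal S_n:w\ge A\}$, and let ${\tt MinPerm}(A)=\{w\in{\tt Perm}(A):\ell(w)=\deg(A)\}$. *The pair $(\boldsymbol\lambda,\mathbf d)$.* Let $\boldsymbol\lambda=(\lambda^{(1)},\dots,\lambda^{(k)})$ be a tuple of partitions and $\mathbf d=(d_1,\dots,d_k)$ a tuple of positive integers such that $d_i$ is at least the number of nonzero parts of $\lambda^{(i)}$ for all $i$. Let $n$ be any integer with $d_i+\lambda^{(i)}_1\le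 n$ for all $i$. For a partition $\lambda$ with at most $d$ nonzero parts and $d+\lambda_1\le n$, let $[\lambda,d]_g\in\mathcal S_n$ be the permutation $u$ with $u(d-p+1)=d-p+1+\lambda_p$ for $1\le p\le d$ and with no descent other than possibly at $d$ (it is the identity if $\lambda$ is empty). Let $A_{\boldsymbol\lambda,\mathbf d}\in\mathsf{ASM}(n)$ be the least upper bound of $[\lambda^{(1)},d_1]_g,\dots,[\lambda^{(k)},d_k]_g$ in $\mathsf{ASM}(n)$. *Prism tableaux.* Place $\lambda^{(i)}$ in the grid $\mathbb Z_{>0}\times\mathbb Z_{>0}$ (matrix coordinates) as the set of boxes $\{(a,b):1\le a\le d_i,\ b\le\lambda^{(i)}_{d_i-a+1}\}$. A prism tableau $\mathcal T$ assigns, for each color $i\in\{1,\dots,k\}$, a label of color $i$ from $\{1,\dots,d_i\}$ to each box of $\lambda^{(i)}$, so that for each color the labels weakly decrease along rows from left to right and strictly decrease along columns from bottom to top. An antidiagonal is a set $\{(m,1),(m-1,2),\dots,(1,m)\}$. The weight of $\mathcal T$ is ${\tt wt}(\mathcal T)=\prod_a x_a^{n_a}$, where $n_a$ is the number of antidiagonals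 that contain the label $a$ (in any color). $\mathcal T$ is minimal if the degree of ${\tt wt}(\mathcal T)$ is the minimum over all prism tableaux for $(\boldsymbol\lambda,\mathbf d)$. Write $a_c$ for a label $a$ of color $c$. An unstable triple of $\mathcal T$ consists of three labels $a_c,a_e,b_f$ in the same antidiagonal, where $a_c\neq a_e$ are two different labels with the same value $a$ (so $c\ne e$) and $a<b$, such that replacing $a_c$ by $b_c$ gives a prism tableau. Let ${\tt Prism}(\boldsymbol\lambda,\mathbf d)$ be the set of minimal prism tableaux with no unstable triples, and let $$\mathfrak A_{\boldsymbol\lambda,\mathbf d}=\sum_{\mathcal T\in{\tt Prism}(\boldsymbol\lambda,\mathbf d)}{\tt wt}(\mathcal T).$$ *Schubert polynomials.* For $w\in\mathcal S_n$ the polynomial $\mathfrak S_w\in\mathbb Z[x_1,x_2,\dots]$ is defined by $\mathfrak S_{w_0}=x_1^{n-1}x_2^{n-2}\cdots x_{n-1}$ for the longest element $w_0$ and $\mathfrak S_w=\partial_i\,\mathfrak S_{ws_i}$ whenever $w(i)<w(i+1)$, where $s_i=(i\ i+1)$ and $\partial_i f=(f-s_if)/(x_i-x_{i+1})$, with $s_i$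 acting on polynomials by exchanging $x_i$ and $x_{i+1}$. **Theorem 1.1.** For all $(\boldsymbol\lambda,\mathbf d)$ and $n$ as above, the least upper bound $A_{\boldsymbol\lambda,\mathbf d}$ exists in $\mathsf{ASM}(n)$ and $$\mathfrak A_{\boldsymbol\lambda,\mathbf d}=\sum_{w\in{\tt MinPerm}(A_{\boldsymbol\lambda,\mathbf d})}\mathfrak S_w .$$ -/

import Mathlib

/-!
Conventions: every index of the classical notation that starts at 1 (rows and columns of a matrix,
positions and values of a permutation, parts of a partition, boxes of the grid, labels of a tableau,
variables of a polynomial) is shifted by one and starts at 0 here. In particular the variable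
`MvPolynomial.X a` stands for `x_{a+1}`, and the label `a` of a tableau stands for `a + 1`.
-/

namespace PrismASM

open scoped BigOperators

/-! ### Alternating sign matrices -/

/-- The nonzero entries of a finite sequence alternate in sign (for entries in `{-1, 0, 1}`):
any two consecutive nonzero entries are opposite. -/
def Alternates {n : ℕ} (f : Fin n → ℤ) : Prop :=
  ∀ j j' : Fin n, j < j' → f j ≠ 0 → f j' ≠ 0 → (∀ m, j < m → m < j' → f m = 0) → f j' = -f j

/-- Alternating sign matrices. -/
structure IsASM {n : ℕ} (M : Matrix (Fin n) (Fin n) ℤ) : Prop where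
  entries : ∀ i j, M i j = -1 ∨ M i j = 0 ∨ M i j = 1
  row_alternates : ∀ i, Alternates (fun j => M i j)
  col_alternates : ∀ j, Alternates (fun i => M i j)
  row_sum : ∀ i, ∑ j, M i j = 1
  col_sum : ∀ j, ∑ i, M i j = 1

/-- The set `ASM(n)`. -/
def ASM (n : ℕ) : Type := {M : Matrix (Fin n) (Fin n) ℤ // IsASM M}

/-- The corner sum function `r_A(i, j)`: the sum of the entries weakly northwest of `(i, j)`. -/
def cornerSum {n : ℕ} (A : ASM n) (i j : Fin n) : ℤ :=
  ∑ k ∈ Finset.Iic i, ∑ l ∈ Finset.Iic j, A.1 k l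

theorem eq_of_sum_Iic_eq {n : ℕ} (f g : Fin n → ℤ)
    (h : ∀ j, ∑ l ∈ Finset.Iic j, f l = ∑ l ∈ Finset.Iic j, g l) : f = g := by
  have key : ∀ m : ℕ, ∀ j : Fin n, j.val = m → f j = g j := by
    intro m
    induction m using Nat.strong_induction_on with
    | _ m ih =>
      intro j hj
      have h1 := h j
      rw [← Finset.Iio_insert j, Finset.sum_insert (by simp), Finset.sum_insert (by simp)] at h1
      have h2 : ∑ l ∈ Finset.Iio j, f l = ∑ l ∈ Finset.Iio j, g l := by
        refine Finset.sum_congr rfl fun l hl => ?_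
        have hl' : l < j := by simpa using hl
        exact ih l.val (by rw [← hj]; exact hl') l rfl
      linarith
  funext j
  exact key j.val j rfl

/-- `A ≤ B` if and only if `r_A(i, j) ≥ r_B(i, j)` for all `i, j`. -/
instance {n : ℕ} : PartialOrder (ASM n) where
  le A B := ∀ i j, cornerSum B i j ≤ cornerSum A i j
  le_refl _ _ _ := le_rfl
  le_trans _ _ _ h h' i j := (h' i j).trans (h i j)
  le_antisymm A B h h' := by
    apply Subtype.ext
    funext i j
    have h1 : ∀ i j, cornerSum A i j = cornerSum B i j := fun i j => le_antisymm (h' i j) (h i j)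
    have h2 : ∀ j, (fun k => ∑ l ∈ Finset.Iic j, A.1 k l) = fun k => ∑ l ∈ Finset.Iic j, B.1 k l :=
      fun j => eq_of_sum_Iic_eq _ _ fun i => h1 i j
    have h3 : A.1 i = B.1 i := eq_of_sum_Iic_eq _ _ fun j => congrFun (h2 j) i
    exact congrFun h3 j

/-! ### Permutations -/

/-- The permutation matrix of `w`, with ones in the positions `(i, w(i))`. -/
def permASM {n : ℕ} (w : Equiv.Perm (Fin n)) : ASM n :=
  ⟨fun i j => if w i = j then 1 else 0, by
    constructor
    · intro i j
      by_cases h : w i = j <;> simp [h]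
    · intro i j j' hj h h' _
      have e : w i = j := by by_contra hc; simp [hc] at h
      have e' : w i = j' := by by_contra hc; simp [hc] at h'
      exact absurd (e.symm.trans e') hj.ne
    · intro j i i' hi h h' _
      have e : w i = j := by by_contra hc; simp [hc] at h
      have e' : w i' = j := by by_contra hc; simp [hc] at h'
      exact absurd (w.injective (e.trans e'.symm)) hi.ne
    · intro i
      simp
    · intro j
      have : ∀ i, (w i = j) = (i = w.symm j) := fun i => propext (Equiv.eq_symm_apply w).symm
      simp [this]⟩

/-- The length of a permutation: its number of inversions. -/
def length {n : ℕ} (w : Equiv.Perm (Fin n)) : ℕ :=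
  (Finset.univ.filter fun p : Fin n × Fin n => p.1 < p.2 ∧ w p.2 < w p.1).card

/-- `deg(A)`, the minimum of the lengths of the permutations above `A`. -/
noncomputable def deg {n : ℕ} (A : ASM n) : ℕ :=
  sInf {m : ℕ | ∃ w : Equiv.Perm (Fin n), A ≤ permASM w ∧ length w = m}

/-- `Perm(A)`, the minimal elements of the set of permutations above `A`. -/
def IsMinimalAbove {n : ℕ} (A : ASM n) (w : Equiv.Perm (Fin n)) : Prop :=
  A ≤ permASM w ∧ ∀ v : Equiv.Perm (Fin n), A ≤ permASM v → permASM v ≤ permASM w → v = w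

open Classical in
/-- `MinPerm(A)`, the elements of `Perm(A)` of length `deg(A)`. -/
noncomputable def minPerm {n : ℕ} (A : ASM n) : Finset (Equiv.Perm (Fin n)) :=
  Finset.univ.filter fun w => IsMinimalAbove A w ∧ length w = deg A

/-! ### Grassmannian permutations

A partition `λ` is a Young diagram `μ`: its parts are `λ_{p+1} = μ.rowLen p`, and its length is
`μ.colLen 0`. -/

/-- The values of the Grassmannian permutation `[λ, d]_g`: in the first `d` positions
`u(d - p) = d - p + λ_{p+1}` (1-based: `u(d-i+1) = d-i+1 + λ_i`), and then the remaining values in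
increasing order. -/
def grassFun (μ : YoungDiagram) (d i : ℕ) : ℕ :=
  if i < d then i + μ.rowLen (d - 1 - i) else i - μ.colLen (i - d)

theorem grassFun_lt (μ : YoungDiagram) {d n i : ℕ} (hn : d + μ.rowLen 0 ≤ n) (hi : i < n) :
    grassFun μ d i < n := by
  unfold grassFun
  have := μ.rowLen_anti 0 (d - 1 - i) (Nat.zero_le _)
  split_ifs <;> omega

theorem grassFun_lt_left (μ : YoungDiagram) {d i j : ℕ} (hij : i < j) (hj : j < d) :
    grassFun μ d i < grassFun μ d j := by
  have := μ.rowLen_anti (d - 1 - j) (d - 1 - i) (by omega)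
  simp only [grassFun, hj, hij.trans hj, if_true]
  omega

theorem grassFun_lt_right (μ : YoungDiagram) {d i j : ℕ} (hl : μ.colLen 0 ≤ d) (hi : d ≤ i)
    (hij : i < j) : grassFun μ d i < grassFun μ d j := by
  have h1 := μ.colLen_anti (i - d) (j - d) (by omega)
  have h2 := μ.colLen_anti 0 (i - d) (Nat.zero_le _)
  simp only [grassFun, show ¬ i < d by omega, show ¬ j < d by omega, if_false]
  omega

theorem grassFun_ne (μ : YoungDiagram) {d i j : ℕ} (hl : μ.colLen 0 ≤ d) (hij : i < j) :
    grassFun μ d i ≠ grassFun μ d j := by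
  by_cases hj : j < d
  · exact (grassFun_lt_left μ hij hj).ne
  by_cases hi : i < d
  · have h1 : j - d < μ.rowLen (d - 1 - i) ↔ d - 1 - i < μ.colLen (j - d) :=
      YoungDiagram.mem_iff_lt_rowLen.symm.trans YoungDiagram.mem_iff_lt_colLen
    have h2 := μ.colLen_anti 0 (j - d) (Nat.zero_le _)
    simp only [grassFun, hi, hj, if_true, if_false]
    omega
  · exact (grassFun_lt_right μ hl (by omega) hij).ne

/-- The Grassmannian permutation `[λ, d]_g` in the symmetric group on `n` letters, for a partition
`λ` of length at most `d` with `λ_1 ≤ n - d`; it is the identity if `λ` is empty. -/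
noncomputable def grassmannian (n : ℕ) (μ : YoungDiagram) (d : ℕ) (hl : μ.colLen 0 ≤ d)
    (hn : d + μ.rowLen 0 ≤ n) : Equiv.Perm (Fin n) :=
  Equiv.ofBijective (fun i => ⟨grassFun μ d i, grassFun_lt μ hn i.2⟩) <|
    Finite.injective_iff_bijective.mp fun i j h => by
      have h' : grassFun μ d i = grassFun μ d j := congrArg Fin.val h
      rcases lt_trichotomy i j with hij | hij | hij
      · exact absurd h' (grassFun_ne μ hl hij)
      · exact hij
      · exact absurd h'.symm (grassFun_ne μ hl hij)

/-- The defining property of `[λ, d]_g`: its value at the position `d - p` (1-based) exceeds that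
position by `λ_{p+1}`, and it has no descent except possibly at `d`. -/
theorem grassmannian_spec (n : ℕ) (μ : YoungDiagram) (d : ℕ) (hl : μ.colLen 0 ≤ d)
    (hn : d + μ.rowLen 0 ≤ n) :
    (∀ i : Fin n, i.val < d → (grassmannian n μ d hl hn i).val = i + μ.rowLen (d - 1 - i)) ∧
    ∀ i j : Fin n, j.val = i.val + 1 → j.val ≠ d →
      grassmannian n μ d hl hn i < grassmannian n μ d hl hn j := by
  refine ⟨fun i hi => by simp [grassmannian, grassFun, hi], fun i j hij hd => ?_⟩
  show grassFun μ d i < grassFun μ d j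
  by_cases hj : j.val < d
  · exact grassFun_lt_left μ (by omega) hj
  · exact grassFun_lt_right μ hl (by omega) (by omega)

/-! ### Prism tableaux -/

/-- Reverse semistandard fillings of `μ` with `d` labels (the label `a : Fin d` stands for `a + 1`).
The cell `(p, q)` of `μ` is the box in row `p` counted from the bottom and in column `q`. Labels
weakly decrease from left to right and strictly decrease from bottom to top. -/
structure IsRSSYT (μ : YoungDiagram) (d : ℕ) (T : μ.cells → Fin d) : Prop where
  row_weak : ∀ c c' : μ.cells, c.1.1 = c'.1.1 → c.1.2 < c'.1.2 → T c' ≤ T c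
  col_strict : ∀ c c' : μ.cells, c.1.2 = c'.1.2 → c.1.1 < c'.1.1 → T c' < T c

/-- `RSSYT(μ, d)`. -/
abbrev RSSYT (μ : YoungDiagram) (d : ℕ) : Type := {T : μ.cells → Fin d // IsRSSYT μ d T}

/-- `AllPrism(λ, d)`: the prism tableaux. -/
abbrev AllPrism {k : ℕ} (lam : Fin k → YoungDiagram) (d : Fin k → ℕ) : Type :=
  ∀ i : Fin k, RSSYT (lam i) (d i)

/-- The colored boxes of a prism tableau: a color `i` and a cell of `λ^{(i)}`. -/
abbrev ColoredBox {k : ℕ} (lam : Fin k → YoungDiagram) : Type := Σ i : Fin k, (lam i).cells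

section

variable {k : ℕ} {lam : Fin k → YoungDiagram} {d : Fin k → ℕ}

/-- The position of a colored box in the ambient grid (matrix coordinates): the bottom row
of `λ^{(i)}` lies in row `d_i` of the grid (row `d_i - 1` when counting from 0). -/
def gridPos (d : Fin k → ℕ) (b : ColoredBox lam) : ℕ × ℕ := (d b.1 - 1 - b.2.1.1, b.2.1.2)

/-- The index of the antidiagonal of the grid which contains a colored box. -/
def antidiag (d : Fin k → ℕ) (b : ColoredBox lam) : ℕ := (gridPos d b).1 + (gridPos d b).2

/-- The label in a colored box (`a` stands for `a + 1`). -/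
def label (T : AllPrism lam d) (b : ColoredBox lam) : ℕ := ((T b.1).1 b.2).val

/-- The number of antidiagonals which contain the label `a`, in any color. -/
def labelCount (T : AllPrism lam d) (a : ℕ) : ℕ :=
  ((Finset.univ.filter fun b : ColoredBox lam => label T b = a).image (antidiag d)).card

/-- The weight monomial of a prism tableau: the product of `x_a ^ (labelCount T a)` over all the
labels `a` which occur in it. -/
noncomputable def wt (T : AllPrism lam d) : MvPolynomial ℕ ℤ :=
  ∏ a ∈ Finset.univ.image (label T), MvPolynomial.X a ^ labelCount T a

/-- Minimal prism tableaux. -/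
def IsMinimalPrism (T : AllPrism lam d) : Prop :=
  ∀ T' : AllPrism lam d, (wt T).totalDegree ≤ (wt T').totalDegree

/-- `T` has an unstable triple: in one antidiagonal there are two different colored boxes `x`, `y`
with the same label and a colored box `z` with a larger label, such that replacing the label of `x`
by that of `z` gives a prism tableau `T'`. -/
def HasUnstableTriple (T : AllPrism lam d) : Prop :=
  ∃ x y z : ColoredBox lam, x ≠ y ∧ antidiag d x = antidiag d y ∧ antidiag d x = antidiag d z ∧
    label T x = label T y ∧ label T x < label T z ∧
    ∃ T' : AllPrism lam d, label T' x = label T z ∧ ∀ b, b ≠ x → label T' b = label T b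

end

open Classical in
/-- `Prism(λ, d)`: the minimal prism tableaux which have no unstable triples. -/
noncomputable def Prism {k : ℕ} (lam : Fin k → YoungDiagram) (d : Fin k → ℕ) :
    Finset (AllPrism lam d) :=
  Finset.univ.filter fun T => IsMinimalPrism T ∧ ¬ HasUnstableTriple T

/-- The ASM polynomial. -/
noncomputable def asmPolynomial {k : ℕ} (lam : Fin k → YoungDiagram) (d : Fin k → ℕ) :
    MvPolynomial ℕ ℤ :=
  ∑ T ∈ Prism lam d, wt T

/-! ### Schubert polynomials -/

/-- The exchange of the variables `x_i` and `x_{i+1}`. -/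
noncomputable def swapVars (i : ℕ) (f : MvPolynomial ℕ ℤ) : MvPolynomial ℕ ℤ :=
  MvPolynomial.rename (Equiv.swap i (i + 1)) f

theorem dvd_sub_swapVars (i : ℕ) (f : MvPolynomial ℕ ℤ) :
    (MvPolynomial.X i - MvPolynomial.X (i + 1) : MvPolynomial ℕ ℤ) ∣ f - swapVars i f := by
  induction f using MvPolynomial.induction_on with
  | C a => simp [swapVars]
  | add p q hp hq =>
    have : p + q - swapVars i (p + q) = (p - swapVars i p) + (q - swapVars i q) := by
      simp only [swapVars, map_add]; ring
    rw [this]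
    exact dvd_add hp hq
  | mul_X p m hp =>
    have h1 : p * MvPolynomial.X m - swapVars i (p * MvPolynomial.X m) =
        (p - swapVars i p) * MvPolynomial.X m +
          swapVars i p * (MvPolynomial.X m - MvPolynomial.X (Equiv.swap i (i + 1) m)) := by
      simp only [swapVars, map_mul, MvPolynomial.rename_X]; ring
    rw [h1]
    refine dvd_add (hp.mul_right _) (Dvd.dvd.mul_left ?_ _)
    rcases eq_or_ne m i with rfl | hi
    · simp
    rcases eq_or_ne m (i + 1) with rfl | hi'
    · rw [Equiv.swap_apply_right, ← neg_sub (MvPolynomial.X i : MvPolynomial ℕ ℤ), dvd_neg]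
    · rw [Equiv.swap_apply_of_ne_of_ne hi hi']
      simp

/-- The divided difference `∂_i f = (f - s_i f) / (x_i - x_{i+1})`. -/
noncomputable def divDiff (i : ℕ) (f : MvPolynomial ℕ ℤ) : MvPolynomial ℕ ℤ :=
  (dvd_sub_swapVars i f).choose

theorem divDiff_spec (i : ℕ) (f : MvPolynomial ℕ ℤ) :
    f - swapVars i f = (MvPolynomial.X i - MvPolynomial.X (i + 1)) * divDiff i f :=
  (dvd_sub_swapVars i f).choose_spec

/-- `w(i) < w(i+1)`. -/
def IsAscent {n : ℕ} (w : Equiv.Perm (Fin n)) (i : ℕ) : Prop :=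
  ∃ h : i + 1 < n, w ⟨i, Nat.lt_of_succ_lt h⟩ < w ⟨i + 1, h⟩

/-- `w s_i`: the permutation `w` with the values in the positions `i` and `i + 1` exchanged. -/
def mulSimple {n : ℕ} (w : Equiv.Perm (Fin n)) (i : ℕ) : Equiv.Perm (Fin n) :=
  if h : i + 1 < n then w * Equiv.swap ⟨i, Nat.lt_of_succ_lt h⟩ ⟨i + 1, h⟩ else w

theorem mulSimple_measure {n : ℕ} (w : Equiv.Perm (Fin n)) (i : ℕ) (h : IsAscent w i) :
    ∑ j : Fin n, j.val * (mulSimple w i j).val < ∑ j : Fin n, j.val * (w j).val := by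
  obtain ⟨hn, hlt⟩ := h
  set a : Fin n := ⟨i, Nat.lt_of_succ_lt hn⟩ with ha
  set b : Fin n := ⟨i + 1, hn⟩ with hb
  have hab : a ≠ b := by simp [ha, hb]
  have e1 : mulSimple w i = w * Equiv.swap a b := by simp [mulSimple, hn, ha, hb]
  have e2 : ∑ j : Fin n, j.val * (mulSimple w i j).val
      = ∑ j : Fin n, (Equiv.swap a b j).val * (w j).val := by
    rw [e1, ← Equiv.sum_comp (Equiv.swap a b)]
    simp
  rw [e2]
  zify
  rw [← sub_pos, ← Finset.sum_sub_distrib]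
  rw [Fintype.sum_eq_add a b hab fun x hx => by
    rw [Equiv.swap_apply_of_ne_of_ne hx.1 hx.2, sub_self]]
  rw [Equiv.swap_apply_left, Equiv.swap_apply_right]
  have hlt' : ((w a).val : ℤ) < (w b).val := by exact_mod_cast hlt
  simp only [ha, hb] at hlt' ⊢
  push_cast
  linarith

open Classical in
/-- The Schubert polynomial of `w`, by the recursion of Lascoux and Schützenberger:
`𝔖_{w₀} = x_1^{n-1} x_2^{n-2} ⋯ x_{n-1}` for the longest element `w₀` (the permutation without
ascents), and `𝔖_w = ∂_i 𝔖_{w s_i}` if `w(i) < w(i+1)`; the recursion uses the first ascent, and the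
divided differences satisfy the braid relations, so that any other ascent gives the same result. -/
noncomputable def schubert {n : ℕ} (w : Equiv.Perm (Fin n)) : MvPolynomial ℕ ℤ :=
  if h : ∃ i, IsAscent w i then
    divDiff (Nat.find h) (schubert (mulSimple w (Nat.find h)))
  else ∏ j : Fin n, MvPolynomial.X j.val ^ (n - 1 - j.val)
termination_by ∑ j : Fin n, j.val * (w j).val
decreasing_by exact mulSimple_measure w _ (Nat.find_spec h)

end PrismASM

namespace PrismASM

open MvPolynomial (X)

/-! Both sides enumerate the same sets of cells. A subset `D` of the staircase, read row by row from
right to left, spells a word in the simple transpositions; let `δ(D)` be its Demazure product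
(`demazureProd`). The claim is that each side equals the sum of `∏ x_a` over the cells of `D`, taken
over all `D` with `A ≤ δ(D)` and `|D| = deg A` (`minimalPipeDreams`).

For the Schubert side, `schubert_eq_sum` writes `𝔖_w` as the sum over reduced pipe dreams of `w`,
that is, over `D` with `δ(D) = w` and `|D| = ℓ(w)`. Since `ℓ(δ(D)) ≤ |D|`, a set of size `deg A`
with `A ≤ δ(D)` is automatically reduced for an element of `MinPerm(A)`; this gives
`sum_schubert_minPerm`. The pipe dream formula comes from the Fomin–Stanley argument: the generating
function is a product in the nilCoxeter algebra, and a Yang–Baxter computation determines its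
divided differences.

For the tableau side, record a prism tableau by its `support`, the set of pairs (label,
antidiagonal). The weight is the product over the support, so minimal tableaux are those of smallest
support. By `grassmannian_le_demazureProd_iff`, `δ(D)` lies above `[λ, d]_g` exactly when `D`
contains the support of a tableau of shape `λ`. As `A` is a least upper bound, `A ≤ δ(D)` holds
exactly when `D` contains the support of some prism tableau. Hence the minimal supports are exactly
the minimal sets `D`. Among the tableaux with a given minimal support, exactly one has no unstable
triple: the one with labelwise largest entries (`eq_of_support_eq`, `exists_mem_Prism_support_eq`).

All order comparisons are made with rank functions. On these, Demazure multiplication is a local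
operation (`rowOp`, `colOp`), and the least upper bound is the pointwise minimum. -/

/-! ### Rank functions of permutations -/

/-- The number of positions `i < p` with `w i < q`. -/
def rank {n : ℕ} (w : Equiv.Perm (Fin n)) (p q : ℕ) : ℤ :=
  ∑ i : Fin n, if i.val < p ∧ (w i).val < q then 1 else 0

section

variable {n : ℕ}

theorem rank_zero_left (w : Equiv.Perm (Fin n)) (q : ℕ) : rank w 0 q = 0 := by
  simp [rank]

theorem rank_zero_right (w : Equiv.Perm (Fin n)) (p : ℕ) : rank w p 0 = 0 := by
  simp [rank]

theorem rank_succ (w : Equiv.Perm (Fin n)) {p : ℕ} (h : p < n) (q : ℕ) :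
    rank w (p + 1) q = rank w p q + if (w ⟨p, h⟩).val < q then 1 else 0 := by
  have : (if (w ⟨p, h⟩).val < q then (1 : ℤ) else 0) =
      ∑ i : Fin n, if i = ⟨p, h⟩ then (if (w i).val < q then (1 : ℤ) else 0) else 0 := by
    simp
  rw [this, rank, rank, ← Finset.sum_add_distrib]
  refine Finset.sum_congr rfl fun i _ => ?_
  have hi : i = ⟨p, h⟩ ↔ i.val = p := Fin.ext_iff
  by_cases h1 : (w i).val < q <;> simp only [h1, hi, and_true, and_false, if_true, if_false]
  · split_ifs <;> omega
  · simp

theorem rank_inv (w : Equiv.Perm (Fin n)) (p q : ℕ) : rank w⁻¹ p q = rank w q p := by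
  unfold rank
  rw [← Equiv.sum_comp w]
  refine Finset.sum_congr rfl fun i _ => ?_
  simp [and_comm]

theorem rank_min_left (w : Equiv.Perm (Fin n)) (p q : ℕ) : rank w (min p n) q = rank w p q := by
  refine Finset.sum_congr rfl fun i _ => ?_
  have := i.2
  simp [this]

theorem rank_min_right (w : Equiv.Perm (Fin n)) (p q : ℕ) : rank w p (min q n) = rank w p q := by
  rw [← rank_inv, rank_min_left, rank_inv]

theorem rank_nonneg (w : Equiv.Perm (Fin n)) (p q : ℕ) : 0 ≤ rank w p q :=
  Finset.sum_nonneg fun i _ => by split_ifs <;> simp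

theorem rank_le_succ_left (w : Equiv.Perm (Fin n)) (p q : ℕ) :
    rank w p q ≤ rank w (p + 1) q ∧ rank w (p + 1) q ≤ rank w p q + 1 := by
  by_cases h : p < n
  · rw [rank_succ w h]
    split_ifs <;> constructor <;> linarith
  · rw [← rank_min_left w p, ← rank_min_left w (p + 1), min_eq_right (by omega),
      min_eq_right (by omega)]
    constructor <;> linarith

theorem rank_le_succ_right (w : Equiv.Perm (Fin n)) (p q : ℕ) :
    rank w p q ≤ rank w p (q + 1) ∧ rank w p (q + 1) ≤ rank w p q + 1 := by
  simpa only [rank_inv] using rank_le_succ_left w⁻¹ q p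

theorem rank_mono (w : Equiv.Perm (Fin n)) {p p' q q' : ℕ} (h : p ≤ p') (h' : q ≤ q') :
    rank w p q ≤ rank w p' q' :=
  (monotone_nat_of_le_succ (f := fun p => rank w p q) (fun p => (rank_le_succ_left w p q).1) h).trans
    (monotone_nat_of_le_succ (f := fun q => rank w p' q) (fun q => (rank_le_succ_right w p' q).1) h')

theorem rank_add_le (w : Equiv.Perm (Fin n)) (p t q : ℕ) : rank w (p + t) q ≤ rank w p q + t := by
  induction t with
  | zero => simp
  | succ t ih =>
    have := (rank_le_succ_left w (p + t) q).2
    push_cast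
    rw [← add_assoc]
    linarith

theorem rank_le_left (w : Equiv.Perm (Fin n)) (p q : ℕ) : rank w p q ≤ p := by
  simpa [rank_zero_left] using rank_add_le w 0 p q

theorem rank_le_right (w : Equiv.Perm (Fin n)) (p q : ℕ) : rank w p q ≤ q := by
  rw [← rank_inv]
  exact rank_le_left _ _ _

theorem rank_top (w : Equiv.Perm (Fin n)) {p : ℕ} (h : p ≤ n) : rank w p n = p := by
  induction p with
  | zero => exact rank_zero_left w n
  | succ p ih =>
    rw [rank_succ w h, ih (by omega)]
    simp

theorem rank_injective {v w : Equiv.Perm (Fin n)} (h : ∀ p q, rank v p q = rank w p q) :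
    v = w := by
  have key : ∀ i : Fin n, ∀ q : ℕ, (v i).val < q ↔ (w i).val < q := by
    intro i q
    have h1 := rank_succ v i.2 q
    have h2 := rank_succ w i.2 q
    rw [h, h, h2] at h1
    split_ifs at h1 with hv hw hw
    · simp [hv, hw]
    · linarith
    · linarith
    · simp [hv, hw]
  ext i
  have h1 := key i ((w i).val + 1)
  have h2 := key i ((v i).val + 1)
  omega

/-- The strict bounds in `rank` let index `0` stand for the empty corner, which the recurrences on
ranks need. -/
theorem cornerSum_permASM (w : Equiv.Perm (Fin n)) (i j : Fin n) :
    cornerSum (permASM w) i j = rank w (i + 1) (j + 1) := by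
  have : ∀ k : Fin n, (∑ l ∈ Finset.Iic j, (permASM w).1 k l) =
      if (w k).val < j.val + 1 then 1 else 0 := by
    intro k
    have h : ∀ l, (permASM w).1 k l = if w k = l then 1 else 0 := fun l => rfl
    simp only [h, Finset.sum_ite_eq, Finset.mem_Iic, Fin.le_def, Nat.lt_succ_iff]
  unfold cornerSum rank
  simp only [this]
  have hI : Finset.Iic i = Finset.univ.filter fun k : Fin n => k ≤ i := by ext; simp
  rw [hI, Finset.sum_filter]
  refine Finset.sum_congr rfl fun k _ => ?_
  by_cases h : k ≤ i
  · simp [h, Nat.lt_succ_iff.2 (Fin.le_def.1 h)]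
  · have : ¬ k.val < i.val + 1 := fun h' => h (Fin.le_def.2 (by omega))
    simp [h, this]

theorem permASM_le_iff {v w : Equiv.Perm (Fin n)} :
    permASM v ≤ permASM w ↔ ∀ p q, rank w p q ≤ rank v p q := by
  constructor
  · intro h p q
    rw [← rank_min_left w, ← rank_min_left v, ← rank_min_right w, ← rank_min_right v]
    rcases hp : min p n with _ | p'
    · simp [rank_zero_left]
    rcases hq : min q n with _ | q'
    · simp [rank_zero_right]
    have := h ⟨p', by omega⟩ ⟨q', by omega⟩
    rwa [cornerSum_permASM, cornerSum_permASM] at this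
  · intro h i j
    rw [cornerSum_permASM, cornerSum_permASM]
    exact h _ _

/-! ### Multiplication by a simple transposition -/

theorem mulSimple_apply_left (w : Equiv.Perm (Fin n)) {m : ℕ} (h : m + 1 < n) :
    mulSimple w m ⟨m, Nat.lt_of_succ_lt h⟩ = w ⟨m + 1, h⟩ := by
  simp [mulSimple, h]

theorem mulSimple_apply_right (w : Equiv.Perm (Fin n)) {m : ℕ} (h : m + 1 < n) :
    mulSimple w m ⟨m + 1, h⟩ = w ⟨m, Nat.lt_of_succ_lt h⟩ := by
  simp [mulSimple, h]

theorem mulSimple_apply_of_ne (w : Equiv.Perm (Fin n)) {m : ℕ} {i : Fin n} (h1 : i.val ≠ m)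
    (h2 : i.val ≠ m + 1) : mulSimple w m i = w i := by
  unfold mulSimple
  split_ifs with h
  · rw [Equiv.Perm.mul_apply, Equiv.swap_apply_of_ne_of_ne]
    · exact fun e => h1 (by rw [e])
    · exact fun e => h2 (by rw [e])
  · rfl

@[simp]
theorem mulSimple_mulSimple (w : Equiv.Perm (Fin n)) (m : ℕ) :
    mulSimple (mulSimple w m) m = w := by
  unfold mulSimple
  split_ifs with h
  · rw [mul_assoc, Equiv.swap_mul_self, mul_one]
  · rfl

theorem IsAscent.lt {w : Equiv.Perm (Fin n)} {m : ℕ} (h : IsAscent w m) : m + 1 < n := h.1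

theorem isAscent_iff (w : Equiv.Perm (Fin n)) {m : ℕ} (h : m + 1 < n) :
    IsAscent w m ↔ w ⟨m, Nat.lt_of_succ_lt h⟩ < w ⟨m + 1, h⟩ :=
  ⟨fun h' => h'.2, fun h' => ⟨h, h'⟩⟩

theorem isAscent_mulSimple (w : Equiv.Perm (Fin n)) {m : ℕ} (h : m + 1 < n) :
    IsAscent (mulSimple w m) m ↔ ¬ IsAscent w m := by
  rw [isAscent_iff _ h, isAscent_iff _ h, mulSimple_apply_left, mulSimple_apply_right, not_lt]
  refine ⟨le_of_lt, fun h' => lt_of_le_of_ne h' fun e => ?_⟩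
  have := congrArg Fin.val (w.injective e)
  simp at this
  exact h

theorem rank_mulSimple_of_ne (w : Equiv.Perm (Fin n)) {m p : ℕ} (hp : p ≠ m + 1) (q : ℕ) :
    rank (mulSimple w m) p q = rank w p q := by
  unfold mulSimple
  split_ifs with h
  · unfold rank
    rw [← Equiv.sum_comp (Equiv.swap (⟨m, Nat.lt_of_succ_lt h⟩ : Fin n) ⟨m + 1, h⟩)]
    refine Finset.sum_congr rfl fun i _ => ?_
    rw [Equiv.Perm.mul_apply, Equiv.swap_apply_self]
    have : (Equiv.swap (⟨m, Nat.lt_of_succ_lt h⟩ : Fin n) ⟨m + 1, h⟩ i).val < p ↔ i.val < p := by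
      rw [Equiv.swap_apply_def]
      split_ifs with h1 h2
      · subst h1; simp; omega
      · subst h2; simp; omega
      · rfl
    simp only [this]
  · rfl

/-- Consecutive rows of a rank function differ by 0 or 1, so row `m + 1` lies between `max (r m) (r
(m + 2) - 1)` and `min (r m + 1) (r (m + 2))`. At an ascent the smaller value is counted first and
the upper extreme is attained; exchanging the two values gives the lower one. -/
theorem rank_of_isAscent {w : Equiv.Perm (Fin n)} {m : ℕ} (h : IsAscent w m) (q : ℕ) :
    rank w (m + 1) q = min (rank w m q + 1) (rank w (m + 2) q) := by
  have h1 := rank_succ w (Nat.lt_of_succ_lt h.lt) q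
  have h2 : rank w (m + 2) q = _ := rank_succ w h.lt q
  have h3 := (isAscent_iff w h.lt).1 h
  rw [Fin.lt_def] at h3
  rw [h2, h1]
  split_ifs <;> omega

theorem rank_mulSimple_of_isAscent {w : Equiv.Perm (Fin n)} {m : ℕ} (h : IsAscent w m) (q : ℕ) :
    rank (mulSimple w m) (m + 1) q = max (rank w m q) (rank w (m + 2) q - 1) := by
  have h1 := rank_succ (mulSimple w m) (Nat.lt_of_succ_lt h.lt) q
  rw [mulSimple_apply_left w h.lt, rank_mulSimple_of_ne w (p := m) (by omega)] at h1
  have h2 : rank w (m + 2) q = _ := rank_succ w h.lt q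
  have h3 := (isAscent_iff w h.lt).1 h
  have h4 := rank_succ w (Nat.lt_of_succ_lt h.lt) q
  rw [Fin.lt_def] at h3
  rw [h1, h2, h4]
  split_ifs <;> omega

theorem length_mulSimple {w : Equiv.Perm (Fin n)} {m : ℕ} (h : IsAscent w m) :
    length (mulSimple w m) = length w + 1 := by
  have hm := h.lt
  set a : Fin n := ⟨m, Nat.lt_of_succ_lt hm⟩ with ha
  set b : Fin n := ⟨m + 1, hm⟩ with hb
  have hab : w a < w b := (isAscent_iff w hm).1 h
  have hs : ∀ i, mulSimple w m i = w (Equiv.swap a b i) := by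
    intro i; simp [mulSimple, hm, ha, hb]
  -- Applying the transposition to both coordinates carries the old inversions to the new ones other
  -- than `(a, b)`, the only pair whose order the transposition reverses.
  have key : (Finset.univ.filter fun p : Fin n × Fin n =>
      p.1 < p.2 ∧ mulSimple w m p.2 < mulSimple w m p.1) =
      insert (a, b) ((Finset.univ.filter fun p : Fin n × Fin n => p.1 < p.2 ∧ w p.2 < w p.1).map
        ((Equiv.prodCongr (Equiv.swap a b) (Equiv.swap a b)).toEmbedding)) := by
    ext ⟨i, j⟩
    simp only [Finset.mem_filter, Finset.mem_univ, true_and, Finset.mem_insert,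
      Finset.mem_map_equiv, Equiv.prodCongr_symm, Equiv.prodCongr_apply, Equiv.symm_swap,
      Prod.map_apply, Prod.mk.injEq, hs]
    have la : ∀ x : Fin n, x ≠ a → x ≠ b → (x < a ↔ x < b) := by
      intro x hx hx'
      simp only [ne_eq, Fin.ext_iff, ha, hb, Fin.lt_def] at *
      omega
    have lb : ∀ x : Fin n, x ≠ a → x ≠ b → (a < x ↔ b < x) := by
      intro x hx hx'
      simp only [ne_eq, Fin.ext_iff, ha, hb, Fin.lt_def] at *
      omega
    have lab : a < b := by simp [ha, hb, Fin.lt_def]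
    rcases eq_or_ne i a with hia | hia
    · rcases eq_or_ne j b with hjb | hjb
      · simp [hia, hjb, lab, hab]
      rcases eq_or_ne j a with hja | hja
      · simp [hia, hja, lab.ne]
      · simp [hia, Equiv.swap_apply_of_ne_of_ne hja hjb, hjb, lb j hja hjb]
    rcases eq_or_ne i b with hib | hib
    · rcases eq_or_ne j b with hjb | hjb
      · simp [hib, hjb, lab.ne']
      rcases eq_or_ne j a with hja | hja
      · simp [hib, hja, lab.ne', lab.not_gt, hab.not_gt]
      · simp [hib, lab.ne', Equiv.swap_apply_of_ne_of_ne hja hjb, lb j hja hjb]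
    rcases eq_or_ne j a with hja | hja
    · simp [Equiv.swap_apply_of_ne_of_ne hia hib, hia, hja, la i hia hib]
    rcases eq_or_ne j b with hjb | hjb
    · simp [Equiv.swap_apply_of_ne_of_ne hia hib, hia, hjb, la i hia hib]
    · simp [Equiv.swap_apply_of_ne_of_ne hia hib, Equiv.swap_apply_of_ne_of_ne hja hjb, hia]
  rw [length, key, Finset.card_insert_of_notMem, Finset.card_map]
  · rfl
  · simp only [Finset.mem_map_equiv, Equiv.prodCongr_symm, Equiv.prodCongr_apply, Equiv.symm_swap,
      Prod.map_apply, Equiv.swap_apply_left, Equiv.swap_apply_right, Finset.mem_filter, not_and]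
    intro _ h'
    simp [ha, hb, Fin.lt_def] at h'

theorem length_mulSimple_of_descent {w : Equiv.Perm (Fin n)} {m : ℕ}
    (h : IsAscent (mulSimple w m) m) : length w = length (mulSimple w m) + 1 := by
  simpa using length_mulSimple h

/-! ### Demazure products -/

open Classical in
/-- The Demazure product `w * s_m`. -/
noncomputable def demazure (w : Equiv.Perm (Fin n)) (m : ℕ) : Equiv.Perm (Fin n) :=
  if IsAscent w m then mulSimple w m else w

theorem demazure_of_isAscent {w : Equiv.Perm (Fin n)} {m : ℕ} (h : IsAscent w m) :
    demazure w m = mulSimple w m := if_pos h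

theorem demazure_of_not_isAscent {w : Equiv.Perm (Fin n)} {m : ℕ} (h : ¬ IsAscent w m) :
    demazure w m = w := if_neg h

/-- The effect on rank functions of the Demazure product with `s_m` on the right. -/
def rowOp (m : ℕ) (r : ℕ → ℕ → ℤ) (p q : ℕ) : ℤ :=
  if p = m + 1 then max (r m q) (r (m + 2) q - 1) else r p q

/-- The effect on rank functions of the Demazure product with `s_m` on the left. -/
def colOp (m : ℕ) (r : ℕ → ℕ → ℤ) (p q : ℕ) : ℤ :=
  if q = m + 1 then max (r p m) (r p (m + 2) - 1) else r p q

/-- Maxima in the row direction and in the column direction can be taken in either order. This is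
the form of associativity of the Demazure product on which the file relies. -/
theorem rowOp_colOp (a b : ℕ) (r : ℕ → ℕ → ℤ) : rowOp a (colOp b r) = colOp b (rowOp a r) := by
  funext p q
  simp only [rowOp, colOp]
  split_ifs <;> omega

theorem rank_demazure (w : Equiv.Perm (Fin n)) {m : ℕ} (hm : m + 1 < n) :
    rank (demazure w m) = rowOp m (rank w) := by
  funext p q
  unfold rowOp
  by_cases h : IsAscent w m
  · rw [demazure_of_isAscent h]
    split_ifs with hp
    · rw [hp, rank_mulSimple_of_isAscent h]
    · exact rank_mulSimple_of_ne w hp q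
  · rw [demazure_of_not_isAscent h]
    split_ifs with hp
    · have := rank_mulSimple_of_isAscent ((isAscent_mulSimple w hm).2 h) q
      rw [mulSimple_mulSimple, rank_mulSimple_of_ne _ (by omega),
        rank_mulSimple_of_ne _ (by omega)] at this
      rw [hp, this]
    · rfl

/-- The Demazure product `s_m * w`. -/
noncomputable def demazureLeft (m : ℕ) (w : Equiv.Perm (Fin n)) : Equiv.Perm (Fin n) :=
  (demazure w⁻¹ m)⁻¹

theorem rank_demazureLeft (w : Equiv.Perm (Fin n)) {m : ℕ} (hm : m + 1 < n) :
    rank (demazureLeft m w) = colOp m (rank w) := by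
  funext p q
  rw [demazureLeft, rank_inv, rank_demazure _ hm]
  simp only [rowOp, colOp, rank_inv]

theorem demazureLeft_demazure (w : Equiv.Perm (Fin n)) {a b : ℕ} (ha : a + 1 < n)
    (hb : b + 1 < n) : demazureLeft a (demazure w b) = demazure (demazureLeft a w) b := by
  refine rank_injective fun p q => ?_
  rw [rank_demazureLeft _ ha, rank_demazure _ hb, rank_demazure _ hb, rank_demazureLeft _ ha,
    rowOp_colOp]

theorem rank_one (p q : ℕ) : rank (1 : Equiv.Perm (Fin n)) p q = min (min p q) n := by
  induction p with
  | zero => simp [rank_zero_left]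
  | succ p ih =>
    by_cases h : p < n
    · rw [rank_succ _ h, ih]
      simp only [Equiv.Perm.coe_one, id_eq]
      split_ifs <;> omega
    · rw [← rank_min_left, show min (p + 1) n = min p n by omega, rank_min_left, ih]
      omega

theorem demazureLeft_one (m : ℕ) :
    demazureLeft m (1 : Equiv.Perm (Fin n)) = demazure 1 m := by
  by_cases hm : m + 1 < n
  · refine rank_injective fun p q => ?_
    rw [rank_demazureLeft _ hm, rank_demazure _ hm]
    simp only [rowOp, colOp, rank_one]
    split_ifs <;> omega
  · have : ∀ w : Equiv.Perm (Fin n), demazure w m = w :=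
      fun w => demazure_of_not_isAscent fun h => hm h.lt
    simp [demazureLeft, this]

/-- One half of the lifting property. Only row `m + 1` can differ between `w` and `w * s_m`, and
there the ascent makes the rank of `v` as large as its rows `m` and `m + 2` permit. -/
theorem permASM_le_of_le_demazure {v w : Equiv.Perm (Fin n)} {m : ℕ} (hm : m + 1 < n)
    (hv : IsAscent v m) (h : permASM v ≤ permASM (demazure w m)) : permASM v ≤ permASM w := by
  rw [permASM_le_iff, rank_demazure _ hm] at h
  rw [permASM_le_iff]
  intro p q
  by_cases hp : p = m + 1
  · have h1 := h m q
    have h2 := h (m + 2) q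
    simp only [rowOp] at h1 h2
    rw [if_neg (by omega)] at h1 h2
    have h3 := rank_le_succ_left w m q
    have h4 := rank_le_succ_left w (m + 1) q
    rw [hp, rank_of_isAscent hv]
    refine le_min ?_ ?_ <;> [skip; rw [show m + 2 = m + 1 + 1 from rfl] at *] <;> linarith
  · have := h p q
    rwa [rowOp, if_neg hp] at this

theorem mulSimple_le_of_le_demazure {v w : Equiv.Perm (Fin n)} {m : ℕ}
    (hv : IsAscent (mulSimple v m) m) (h : permASM v ≤ permASM (demazure w m)) :
    permASM (mulSimple v m) ≤ permASM w := by
  refine permASM_le_of_le_demazure hv.lt hv (le_trans ?_ h)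
  rw [permASM_le_iff]
  intro p q
  have := rank_demazure (mulSimple v m) hv.lt
  rw [demazure_of_isAscent hv, mulSimple_mulSimple] at this
  rw [this, rowOp]
  split_ifs with hp
  · have h3 := rank_le_succ_left (mulSimple v m) m q
    have h4 := rank_le_succ_left (mulSimple v m) (m + 1) q
    rw [hp]
    refine max_le ?_ ?_ <;> [skip; rw [show m + 2 = m + 1 + 1 from rfl] at *] <;> linarith
  · rfl

end

/-! ### Pipe dreams

A cell of the staircase is recorded as a pair `(a, m)`, where `a` is its row and `m` its
antidiagonal. -/

/-- The staircase: the cells strictly above the main antidiagonal of the `n × n` grid. -/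
def staircase (n : ℕ) : Finset (ℕ × ℕ) :=
  (Finset.range n ×ˢ Finset.range n).filter fun c => c.1 ≤ c.2 ∧ c.2 + 1 < n

theorem mem_staircase {n : ℕ} {c : ℕ × ℕ} : c ∈ staircase n ↔ c.1 ≤ c.2 ∧ c.2 + 1 < n := by
  simp only [staircase, Finset.mem_filter, Finset.mem_product, Finset.mem_range]
  omega

/-- The cells of row `a` on the antidiagonals `i + len - 1, …, i`, in this order. -/
def rowCells (a : ℕ) : ℕ → ℕ → List (ℕ × ℕ)
  | _, 0 => []
  | i, len + 1 => rowCells a (i + 1) len ++ [(a, i)]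

/-- The cells of the first `a` rows of the staircase in reading order: rows from top to bottom,
each from right to left. -/
def cells (n : ℕ) : ℕ → List (ℕ × ℕ)
  | 0 => []
  | a + 1 => cells n a ++ rowCells a a (n - 1 - a)

/-- The cell `c` is read before the cell `c'`. -/
def ReadBefore (c c' : ℕ × ℕ) : Prop := c.1 < c'.1 ∨ c.1 = c'.1 ∧ c'.2 < c.2

theorem mem_rowCells {a i len : ℕ} {c : ℕ × ℕ} :
    c ∈ rowCells a i len ↔ c.1 = a ∧ i ≤ c.2 ∧ c.2 < i + len := by
  induction len generalizing i with
  | zero => simp [rowCells]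
  | succ len ih =>
    obtain ⟨b, m⟩ := c
    simp only [rowCells, List.mem_append, ih, List.mem_singleton, Prod.mk.injEq]
    omega

theorem mem_cells {n a : ℕ} {c : ℕ × ℕ} : c ∈ cells n a ↔ c.1 < a ∧ c ∈ staircase n := by
  induction a with
  | zero => simp [cells]
  | succ a ih =>
    simp only [cells, List.mem_append, ih, mem_rowCells, mem_staircase]
    omega

theorem mem_cells_self {n : ℕ} {c : ℕ × ℕ} : c ∈ cells n n ↔ c ∈ staircase n := by
  simp only [mem_cells, mem_staircase]
  omega

theorem pairwise_rowCells (a i len : ℕ) : (rowCells a i len).Pairwise ReadBefore := by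
  induction len generalizing i with
  | zero => simp [rowCells]
  | succ len ih =>
    refine List.pairwise_append.2 ⟨ih _, List.pairwise_singleton _ _, fun c hc c' hc' => ?_⟩
    rw [mem_rowCells] at hc
    rw [List.mem_singleton] at hc'
    subst hc'
    exact Or.inr ⟨hc.1, hc.2.1⟩

theorem pairwise_cells (n a : ℕ) : (cells n a).Pairwise ReadBefore := by
  induction a with
  | zero => simp [cells]
  | succ a ih =>
    refine List.pairwise_append.2 ⟨ih, pairwise_rowCells _ _ _, fun c hc c' hc' => ?_⟩
    rw [mem_rowCells] at hc'
    rw [mem_cells] at hc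
    exact Or.inl (by omega)

theorem nodup_cells (n a : ℕ) : (cells n a).Nodup :=
  (pairwise_cells n a).imp fun {c c'} h e => by
    subst e
    unfold ReadBefore at h
    omega

/-! ### Demazure products of subwords and the subword property. -/

section

variable {n : ℕ}

open Classical in
/-- The Demazure product of the letters of the cells of `D` which occur in the list `L`. -/
noncomputable def demazureProd (n : ℕ) (L : List (ℕ × ℕ)) (D : Finset (ℕ × ℕ)) :
    Equiv.Perm (Fin n) :=
  L.foldl (fun w c => if c ∈ D then demazure w c.2 else w) 1

theorem demazureProd_nil (D : Finset (ℕ × ℕ)) : demazureProd n [] D = 1 := rfl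

theorem demazureProd_append_of_mem (L : List (ℕ × ℕ)) {D : Finset (ℕ × ℕ)} {c : ℕ × ℕ}
    (h : c ∈ D) : demazureProd n (L ++ [c]) D = demazure (demazureProd n L D) c.2 := by
  simp [demazureProd, h]

theorem demazureProd_append_of_notMem (L : List (ℕ × ℕ)) {D : Finset (ℕ × ℕ)} {c : ℕ × ℕ}
    (h : c ∉ D) : demazureProd n (L ++ [c]) D = demazureProd n L D := by
  simp [demazureProd, h]

theorem demazureProd_congr (L : List (ℕ × ℕ)) {D D' : Finset (ℕ × ℕ)}
    (h : ∀ c ∈ L, c ∈ D ↔ c ∈ D') : demazureProd n L D = demazureProd n L D' := by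
  induction L using List.reverseRecOn with
  | nil => rfl
  | append_singleton L c ih =>
    have ih' := ih fun c hc => h c (List.mem_append_left _ hc)
    have hc := h c (by simp)
    by_cases hD : c ∈ D
    · rw [demazureProd_append_of_mem L hD, demazureProd_append_of_mem L (hc.1 hD), ih']
    · rw [demazureProd_append_of_notMem L hD,
        demazureProd_append_of_notMem L fun h' => hD (hc.2 h'), ih']

theorem demazureProd_cons_of_notMem (L : List (ℕ × ℕ)) {D : Finset (ℕ × ℕ)} {c : ℕ × ℕ}
    (h : c ∉ D) : demazureProd n (c :: L) D = demazureProd n L D := by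
  simp [demazureProd, h]

/-- The fold multiplies on the right. Because left and right Demazure multiplications commute, words
can also be built from their last letter backwards, which the later inductions do. -/
theorem demazureProd_cons_of_mem (L : List (ℕ × ℕ)) {D : Finset (ℕ × ℕ)} {c : ℕ × ℕ}
    (hc : c.2 + 1 < n) (hL : ∀ b ∈ L, b.2 + 1 < n) (h : c ∈ D) :
    demazureProd n (c :: L) D = demazureLeft c.2 (demazureProd n L D) := by
  induction L using List.reverseRecOn with
  | nil =>
    rw [demazureProd_nil, demazureLeft_one, ← List.nil_append [c],
      demazureProd_append_of_mem _ h, demazureProd_nil]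
  | append_singleton L b ih =>
    have ih' := ih fun b hb => hL b (List.mem_append_left _ hb)
    have hb := hL b (by simp)
    rw [← List.cons_append]
    by_cases hD : b ∈ D
    · rw [demazureProd_append_of_mem _ hD, demazureProd_append_of_mem _ hD, ih',
        demazureLeft_demazure _ hc hb]
    · rw [demazureProd_append_of_notMem _ hD, demazureProd_append_of_notMem _ hD, ih']

theorem length_one : length (1 : Equiv.Perm (Fin n)) = 0 := by
  rw [length, Finset.card_eq_zero, Finset.filter_eq_empty_iff]
  rintro ⟨i, j⟩ _ ⟨h, h'⟩
  exact absurd h h'.not_gt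

theorem length_demazure_le (w : Equiv.Perm (Fin n)) (m : ℕ) :
    length (demazure w m) ≤ length w + 1 := by
  by_cases h : IsAscent w m
  · rw [demazure_of_isAscent h, length_mulSimple h]
  · rw [demazure_of_not_isAscent h]
    exact Nat.le_succ _

theorem notMem_of_nodup_append {L : List (ℕ × ℕ)} {c : ℕ × ℕ} (h : (L ++ [c]).Nodup) : c ∉ L :=
  fun hc => (List.nodup_append.1 h).2.2 c hc c (by simp) rfl

theorem demazureProd_erase {L : List (ℕ × ℕ)} {c : ℕ × ℕ} (h : c ∉ L) (D : Finset (ℕ × ℕ)) :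
    demazureProd n L (D.erase c) = demazureProd n L D :=
  demazureProd_congr L fun b hb => by
    have : b ≠ c := fun e => h (e ▸ hb)
    simp [this]

theorem demazureProd_insert {L : List (ℕ × ℕ)} {c : ℕ × ℕ} (h : c ∉ L) (D : Finset (ℕ × ℕ)) :
    demazureProd n L (insert c D) = demazureProd n L D :=
  demazureProd_congr L fun b hb => by
    have : b ≠ c := fun e => h (e ▸ hb)
    simp [this]

theorem erase_subset_toFinset {L : List (ℕ × ℕ)} {c : ℕ × ℕ} {D : Finset (ℕ × ℕ)}
    (h : D ⊆ (L ++ [c]).toFinset) : D.erase c ⊆ L.toFinset := fun b hb => by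
  obtain ⟨h1, h2⟩ := Finset.mem_erase.1 hb
  simpa [h1] using h h2

theorem length_demazureProd_le {L : List (ℕ × ℕ)} (hL : L.Nodup) {D : Finset (ℕ × ℕ)}
    (hD : D ⊆ L.toFinset) : length (demazureProd n L D) ≤ D.card := by
  induction L using List.reverseRecOn generalizing D with
  | nil => simp [demazureProd_nil, length_one]
  | append_singleton L c ih =>
    have hc := notMem_of_nodup_append hL
    have := ih (List.nodup_append.1 hL).1 (erase_subset_toFinset hD)
    rw [demazureProd_erase hc] at this
    by_cases h : c ∈ D
    · rw [demazureProd_append_of_mem L h]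
      have h1 := Finset.card_erase_add_one h
      have h2 := length_demazure_le (demazureProd n L D) c.2
      omega
    · rw [demazureProd_append_of_notMem L h]
      rwa [Finset.erase_eq_of_notMem h] at this

theorem permASM_injective : Function.Injective (permASM (n := n)) := fun _ _ h =>
  rank_injective fun p q =>
    le_antisymm (permASM_le_iff.1 h.ge p q) (permASM_le_iff.1 h.le p q)

theorem eq_one_of_le_one {v : Equiv.Perm (Fin n)} (h : permASM v ≤ permASM 1) : v = 1 := by
  refine permASM_injective (le_antisymm h (permASM_le_iff.2 fun p q => ?_))
  rw [rank_one]
  have h1 := rank_le_left v p q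
  have h2 := rank_le_right v p q
  have h3 : rank v p q ≤ n := by
    rw [← rank_min_left]
    refine (rank_le_left _ _ _).trans ?_
    exact_mod_cast min_le_right _ _
  push_cast
  exact le_min (le_min h1 h2) h3

/-- The subword property of the Bruhat order. -/
theorem exists_subword {L : List (ℕ × ℕ)} (hL : L.Nodup) (hn : ∀ c ∈ L, c.2 + 1 < n)
    {D : Finset (ℕ × ℕ)} (hD : D ⊆ L.toFinset) {v : Equiv.Perm (Fin n)}
    (hv : permASM v ≤ permASM (demazureProd n L D)) :
    ∃ D' ⊆ D, demazureProd n L D' = v ∧ D'.card = length v := by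
  induction L using List.reverseRecOn generalizing D v with
  | nil =>
    rw [demazureProd_nil] at hv
    rw [eq_one_of_le_one hv]
    exact ⟨∅, by simp, demazureProd_nil _, by simp [length_one]⟩
  | append_singleton L c ih =>
    have hc := notMem_of_nodup_append hL
    have hcn := hn c (by simp)
    replace ih := @ih (List.nodup_append.1 hL).1 (fun b hb => hn b (List.mem_append_left _ hb))
      (D.erase c) (erase_subset_toFinset hD)
    rw [demazureProd_erase hc] at ih
    have key : ∀ v : Equiv.Perm (Fin n), permASM v ≤ permASM (demazureProd n L D) →
        ∃ D' ⊆ D, demazureProd n (L ++ [c]) D' = v ∧ D'.card = length v := by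
      intro v hv
      obtain ⟨D', h1, h2, h3⟩ := ih hv
      refine ⟨D', h1.trans (Finset.erase_subset _ _), ?_, h3⟩
      rwa [demazureProd_append_of_notMem]
      exact fun h => Finset.notMem_erase c D (h1 h)
    by_cases h : c ∈ D
    · rw [demazureProd_append_of_mem L h] at hv
      -- Lifting property: if `v` ascends at the letter of `c`, then `v` is already below the
      -- product without `c`; otherwise `v s_m` is, and `c` is put back as the last letter.
      by_cases ha : IsAscent v c.2
      · exact key v (permASM_le_of_le_demazure hcn ha hv)
      · have ha' := (isAscent_mulSimple v hcn).2 ha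
        obtain ⟨D', h1, h2, h3⟩ := ih (mulSimple_le_of_le_demazure ha' hv)
        have hcD : c ∉ D' := fun h => Finset.notMem_erase c D (h1 h)
        refine ⟨insert c D', ?_, ?_, ?_⟩
        · exact Finset.insert_subset h (h1.trans (Finset.erase_subset _ _))
        · rw [demazureProd_append_of_mem _ (Finset.mem_insert_self _ _), demazureProd_insert hc,
            h2, demazure_of_isAscent ha', mulSimple_mulSimple]
        · rw [Finset.card_insert_of_notMem hcD, h3, length_mulSimple_of_descent ha']
    · rw [demazureProd_append_of_notMem L h] at hv
      exact key v hv

/-! ### The Demazure product of the whole staircase -/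

/-- A bound for the ranks of the Demazure product of the rows of the staircase from row `a` on. -/
def stairBound (n a p q : ℕ) : ℤ := max (min (min p q) a) (p + q - n)

/-- The bound moves from `a + 1` to `a` one column at a time: when the letters `i, i + 1, …` remain
to be applied on the left, the columns up to `i` already satisfy the new bound. Column `n` needs no
letter, since its ranks are forced. -/
theorem rank_foldr_rowCells {a i len : ℕ} (hi : a ≤ i) (hlen : i + len + 1 = n)
    (w : Equiv.Perm (Fin n))
    (hw : ∀ p ≤ n, ∀ q ≤ n, rank w p q ≤
      if q ≤ i then stairBound n a p q else stairBound n (a + 1) p q) :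
    ∀ p ≤ n, ∀ q ≤ n, rank ((rowCells a i len).foldr (fun c w => demazureLeft c.2 w) w) p q ≤
      stairBound n a p q := by
  induction len generalizing i w with
  | zero =>
    intro p hp q hq
    rw [rowCells, List.foldr_nil]
    rcases Nat.lt_or_ge i q with h | h
    · have : q = n := by omega
      rw [this, rank_top w hp, stairBound]
      exact le_max_of_le_right (by linarith)
    · have := hw p hp q hq
      rwa [if_pos h] at this
  | succ len ih =>
    rw [rowCells, List.foldr_append]
    refine ih (by omega) (by omega) _ fun p hp q hq => ?_
    rw [List.foldr_cons, List.foldr_nil, rank_demazureLeft _ (by show i + 1 < n; omega)]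
    simp only [colOp]
    split_ifs with h1 h2 h3
    · have e1 := hw p hp i (by omega)
      have e2 := hw p hp (i + 2) (by omega)
      rw [if_pos le_rfl] at e1
      rw [if_neg (by omega)] at e2
      simp only [stairBound] at e1 e2 ⊢
      push_cast at e1 e2 ⊢
      subst h1
      push_cast
      omega
    · omega
    · have := hw p hp q hq
      rwa [if_pos (by omega)] at this
    · have := hw p hp q hq
      rwa [if_neg (by omega)] at this

theorem rank_foldr_cells {a : ℕ} (ha : a ≤ n) (w : Equiv.Perm (Fin n))
    (hw : ∀ p ≤ n, ∀ q ≤ n, rank w p q ≤ stairBound n a p q) :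
    ∀ p ≤ n, ∀ q ≤ n, rank ((cells n a).foldr (fun c w => demazureLeft c.2 w) w) p q ≤
      stairBound n 0 p q := by
  induction a generalizing w with
  | zero => exact hw
  | succ a ih =>
    rw [cells, List.foldr_append]
    refine ih (by omega) _ (rank_foldr_rowCells le_rfl (by omega) w fun p hp q hq => ?_)
    have := hw p hp q hq
    split_ifs with h
    · simp only [stairBound] at this ⊢
      push_cast at this ⊢
      omega
    · exact this

theorem demazureProd_eq_foldr {L : List (ℕ × ℕ)} (hL : ∀ c ∈ L, c.2 + 1 < n)
    {D : Finset (ℕ × ℕ)} (hD : ∀ c ∈ L, c ∈ D) :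
    demazureProd n L D = L.foldr (fun c w => demazureLeft c.2 w) 1 := by
  induction L with
  | nil => rfl
  | cons c L ih =>
    rw [demazureProd_cons_of_mem L (hL c (by simp)) (fun b hb => hL b (by simp [hb]))
      (hD c (by simp)), ih (fun b hb => hL b (by simp [hb])) (fun b hb => hD b (by simp [hb]))]
    rfl

theorem letter_lt_of_mem_cells {c : ℕ × ℕ} (h : c ∈ cells n n) : c.2 + 1 < n :=
  (mem_staircase.1 (mem_cells_self.1 h)).2

/-- The bound `stairBound` interpolates between the identity (`a = n`) and `max 0 (p + q - n)` (`a =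
0`), which is a lower bound for the ranks of every permutation. Thus the staircase produces a
greatest element of the Bruhat order. -/
theorem le_demazureProd_staircase (v : Equiv.Perm (Fin n)) :
    permASM v ≤ permASM (demazureProd n (cells n n) (staircase n)) := by
  rw [permASM_le_iff]
  intro p q
  rw [← rank_min_left, ← rank_min_right, ← rank_min_left v, ← rank_min_right v,
    demazureProd_eq_foldr (fun c => letter_lt_of_mem_cells) (fun c => mem_cells_self.1)]
  have hp : min p n ≤ n := min_le_right _ _
  have hq : min q n ≤ n := min_le_right _ _
  generalize min p n = p at *
  generalize min q n = q at *
  refine (rank_foldr_cells le_rfl 1 (fun p hp q hq => ?_) p hp q hq).trans ?_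
  · rw [rank_one, stairBound]
    push_cast
    exact le_max_left _ _
  · have h1 := rank_add_le v⁻¹ q (n - q) p
    rw [Nat.add_sub_cancel' hq, rank_inv, rank_inv, rank_top v hp] at h1
    have h2 := rank_nonneg v p q
    rw [stairBound]
    omega

/-! ### Reduced pipe dreams -/

open Classical in
/-- The reduced pipe dreams of `w`. -/
noncomputable def reducedPipeDreams (w : Equiv.Perm (Fin n)) : Finset (Finset (ℕ × ℕ)) :=
  (staircase n).powerset.filter fun D => demazureProd n (cells n n) D = w ∧ D.card = length w

theorem mem_reducedPipeDreams {w : Equiv.Perm (Fin n)} {D : Finset (ℕ × ℕ)} :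
    D ∈ reducedPipeDreams w ↔
      D ⊆ staircase n ∧ demazureProd n (cells n n) D = w ∧ D.card = length w := by
  simp [reducedPipeDreams]

theorem toFinset_cells : (cells n n).toFinset = staircase n := by
  ext c
  rw [List.mem_toFinset, mem_cells_self]

theorem exists_reducedPipeDream_subset {D : Finset (ℕ × ℕ)} (hD : D ⊆ staircase n)
    {v : Equiv.Perm (Fin n)} (hv : permASM v ≤ permASM (demazureProd n (cells n n) D)) :
    ∃ D' ⊆ D, D' ∈ reducedPipeDreams v := by
  obtain ⟨D', h1, h2, h3⟩ := exists_subword (nodup_cells n n) (fun c => letter_lt_of_mem_cells)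
    (by rwa [toFinset_cells]) hv
  exact ⟨D', h1, mem_reducedPipeDreams.2 ⟨h1.trans hD, h2, h3⟩⟩

theorem reducedPipeDreams_nonempty (v : Equiv.Perm (Fin n)) : (reducedPipeDreams v).Nonempty := by
  obtain ⟨D, -, h⟩ := exists_reducedPipeDream_subset subset_rfl (le_demazureProd_staircase v)
  exact ⟨D, h⟩

theorem length_demazureProd_cells_le {D : Finset (ℕ × ℕ)} (hD : D ⊆ staircase n) :
    length (demazureProd n (cells n n) D) ≤ D.card :=
  length_demazureProd_le (nodup_cells n n) (by rwa [toFinset_cells])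

/-- A reduced pipe dream of `w` contains one of `v`; the lengths are their sizes, so the two
coincide. -/
theorem eq_of_le_of_length_le {v w : Equiv.Perm (Fin n)} (h : permASM v ≤ permASM w)
    (hl : length w ≤ length v) : v = w := by
  obtain ⟨D, hD⟩ := reducedPipeDreams_nonempty w
  rw [mem_reducedPipeDreams] at hD
  obtain ⟨D', h1, h2⟩ := exists_reducedPipeDream_subset hD.1 (v := v) (by rwa [hD.2.1])
  rw [mem_reducedPipeDreams] at h2
  have : D' = D := Finset.eq_of_subset_of_card_le h1 (by rw [hD.2.2, h2.2.2]; exact hl)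
  rw [← h2.2.1, this, hD.2.1]

/-- Such a `w` is decreasing, so every pair is an inversion; the cell `(a, m)` is matched with the
pair `(a, m + 1)`. It follows that the whole staircase is its only reduced pipe dream. -/
theorem card_staircase_le_length {w : Equiv.Perm (Fin n)} (hw : ∀ m, ¬ IsAscent w m) :
    (staircase n).card ≤ length w := by
  have anti : ∀ t : ℕ, ∀ i j : Fin n, j.val = i.val + t + 1 → w j < w i := by
    intro t
    induction t with
    | zero =>
      intro i j hij
      have h1 : i.val + 1 < n := by omega
      have h2 := hw i
      rw [isAscent_iff _ h1, not_lt] at h2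
      have h3 : (⟨i.val + 1, h1⟩ : Fin n) = j := Fin.ext (by simp [hij])
      rw [h3] at h2
      refine lt_of_le_of_ne h2 fun e => ?_
      have := congrArg Fin.val (w.injective e)
      simp only [hij] at this
      omega
    | succ t ih =>
      intro i j hij
      have h1 : i.val + t + 1 < n := by omega
      refine lt_trans ?_ (ih i ⟨i.val + t + 1, h1⟩ rfl)
      have h2 := hw (i.val + t + 1)
      have h4 : i.val + t + 1 + 1 < n := by omega
      rw [isAscent_iff _ h4, not_lt] at h2
      have h3 : (⟨i.val + t + 1 + 1, h4⟩ : Fin n) = j := Fin.ext (by simp only [hij]; omega)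
      rw [h3] at h2
      refine lt_of_le_of_ne h2 fun e => ?_
      have := congrArg Fin.val (w.injective e)
      simp only [hij] at this
      omega
  have hinj : ((Finset.univ.filter fun p : Fin n × Fin n => p.1 < p.2 ∧ w p.2 < w p.1).image
      fun p => (p.1.val, p.2.val - 1)).card ≤ length w := Finset.card_image_le
  refine le_trans (Finset.card_le_card fun c hc => ?_) hinj
  rw [mem_staircase] at hc
  rw [Finset.mem_image]
  refine ⟨(⟨c.1, by omega⟩, ⟨c.2 + 1, hc.2⟩), ?_, by simp⟩
  simp only [Finset.mem_filter, Finset.mem_univ, true_and]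
  refine ⟨Fin.lt_def.2 (by show c.1 < c.2 + 1; omega), ?_⟩
  exact anti (c.2 - c.1) _ _ (by show c.2 + 1 = c.1 + (c.2 - c.1) + 1; omega)

theorem reducedPipeDreams_of_forall_not_isAscent {w : Equiv.Perm (Fin n)}
    (hw : ∀ m, ¬ IsAscent w m) : reducedPipeDreams w = {staircase n} := by
  have h1 : ∀ D ∈ reducedPipeDreams w, D = staircase n := fun D hD => by
    rw [mem_reducedPipeDreams] at hD
    exact Finset.eq_of_subset_of_card_le hD.1 (by rw [hD.2.2]; exact card_staircase_le_length hw)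
  exact Finset.eq_singleton_iff_nonempty_unique_mem.2 ⟨reducedPipeDreams_nonempty w, h1⟩

end

/-! ### NilCoxeter algebras -/

section NilCoxeter

variable {R E : Type*} [CommRing R] [Ring E] [Algebra R E]

/-- The relations of the generators of the nilCoxeter algebra. -/
structure IsNilCoxeter (u : ℕ → E) : Prop where
  sq : ∀ i, u i * u i = 0
  comm : ∀ i j, i + 2 ≤ j → u i * u j = u j * u i
  braid : ∀ i, u i * u (i + 1) * u i = u (i + 1) * u i * u (i + 1)

/-- The factor `1 + x u_i`. -/
def factor (u : ℕ → E) (i : ℕ) (x : R) : E := 1 + x • u i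

/-- The product `(1 + x u_i) (1 + x u_{i+1}) ⋯` of `len` factors. -/
def rowProd (u : ℕ → E) (x : R) : ℕ → ℕ → E
  | _, 0 => 1
  | i, len + 1 => factor u i x * rowProd u x (i + 1) len

variable {u : ℕ → E}

theorem IsNilCoxeter.factor_mul_factor (hu : IsNilCoxeter u) (i : ℕ) (x y : R) :
    factor u i x * factor u i y = factor u i (x + y) := by
  simp only [factor, mul_add, add_mul, mul_one, one_mul, smul_mul_assoc, mul_smul_comm, hu.sq,
    smul_zero]
  module

theorem factor_zero (i : ℕ) : factor u i (0 : R) = 1 := by simp [factor]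

theorem IsNilCoxeter.yangBaxter (hu : IsNilCoxeter u) (i : ℕ) (x y : R) :
    factor u i x * factor u (i + 1) (x + y) * factor u i y =
      factor u (i + 1) y * factor u i (x + y) * factor u (i + 1) x := by
  have h1 := hu.sq i
  have h2 := hu.sq (i + 1)
  have h3 := hu.braid i
  simp only [factor, mul_add, add_mul, mul_one, one_mul, smul_mul_assoc, mul_smul_comm, h1, h2, h3,
    smul_zero]
  module

theorem IsNilCoxeter.commute_rowProd (hu : IsNilCoxeter u) {i j : ℕ} (h : i + 2 ≤ j) (x : R)
    (len : ℕ) : Commute (u i) (rowProd u x j len) := by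
  induction len generalizing j with
  | zero => exact Commute.one_right _
  | succ len ih =>
    have : Commute (u i) (u j) := hu.comm i j h
    exact ((Commute.one_right _).add_right (this.smul_right x)).mul_right (ih (by omega))

theorem IsNilCoxeter.factor_commute_rowProd (hu : IsNilCoxeter u) {i j : ℕ} (h : i + 2 ≤ j)
    (y x : R) (len : ℕ) : Commute (factor u i y) (rowProd u x j len) :=
  (Commute.one_left _).add_left ((hu.commute_rowProd h x len).smul_left y)

/-- This is the source of symmetry in two adjacent variables. The leading factor of the second row
is moved past the tail of the first, and Yang–Baxter exchanges `x` and `y` at the cost of a factor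
at `i + 1` with parameter `y - x`. Part of it restores a full row from `i + 1`, where induction
applies; the remaining parameter `-x` then cancels. -/
theorem IsNilCoxeter.rowProd_comm (hu : IsNilCoxeter u) (x y : R) (len : ℕ) :
    ∀ i, rowProd u y i len * rowProd u x i len = rowProd u x i len * rowProd u y i len := by
  induction len with
  | zero => intro i; rfl
  | succ len ih =>
    intro i
    cases len with
    | zero =>
      simp only [rowProd, mul_one, hu.factor_mul_factor, add_comm]
    | succ len =>
      have e : ∀ z : R, rowProd u z i (len + 1 + 1) =
        factor u i z * (factor u (i + 1) z * rowProd u z (i + 2) len) := fun z => rfl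
      have e' : ∀ z : R, rowProd u z (i + 1) (len + 1) =
        factor u (i + 1) z * rowProd u z (i + 2) len := fun z => rfl
      have c : ∀ z t : R, rowProd u z (i + 2) len * factor u i t =
          factor u i t * rowProd u z (i + 2) len := fun z t =>
        (hu.factor_commute_rowProd le_rfl t z len).eq.symm
      -- Yang–Baxter with parameters `y - x` and `x`, after splitting `factor u i y` additively.
      have yb : factor u i y * factor u (i + 1) y * factor u i x =
          factor u i x * factor u (i + 1) x * factor u i y * factor u (i + 1) (y - x) := by
        have h1 := hu.yangBaxter i (y - x) x
        rw [sub_add_cancel] at h1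
        have h2 : factor u i y = factor u i x * factor u i (y - x) := by
          rw [hu.factor_mul_factor, add_sub_cancel]
        calc _ = factor u i x * (factor u i (y - x) * factor u (i + 1) y * factor u i x) := by
              rw [h2]; simp only [mul_assoc]
          _ = _ := by rw [h1]; simp only [mul_assoc]
      have cancel : factor u (i + 1) (-x) * rowProd u x (i + 1) (len + 1) =
          rowProd u x (i + 2) len := by
        rw [e', ← mul_assoc, hu.factor_mul_factor, neg_add_cancel, factor_zero, one_mul]
      have shift : factor u (i + 1) (y - x) * rowProd u y (i + 2) len =
          factor u (i + 1) (-x) * rowProd u y (i + 1) (len + 1) := by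
        rw [e', ← mul_assoc, hu.factor_mul_factor, sub_eq_neg_add]
      calc rowProd u y i (len + 1 + 1) * rowProd u x i (len + 1 + 1)
          = factor u i y * factor u (i + 1) y * (rowProd u y (i + 2) len * factor u i x) *
              rowProd u x (i + 1) (len + 1) := by
            rw [e, e, e']; simp only [mul_assoc]
        _ = factor u i y * factor u (i + 1) y * factor u i x * rowProd u y (i + 2) len *
              rowProd u x (i + 1) (len + 1) := by
            rw [c]; simp only [mul_assoc]
        _ = factor u i x * factor u (i + 1) x * factor u i y *
              (factor u (i + 1) (y - x) * rowProd u y (i + 2) len) *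
              rowProd u x (i + 1) (len + 1) := by
            rw [yb]; simp only [mul_assoc]
        _ = factor u i x * factor u (i + 1) x * factor u i y * factor u (i + 1) (-x) *
              (rowProd u y (i + 1) (len + 1) * rowProd u x (i + 1) (len + 1)) := by
            rw [shift]; simp only [mul_assoc]
        _ = factor u i x * factor u (i + 1) x * factor u i y *
              (factor u (i + 1) (-x) * rowProd u x (i + 1) (len + 1)) *
              rowProd u y (i + 1) (len + 1) := by
            rw [ih]; simp only [mul_assoc]
        _ = factor u i x * factor u (i + 1) x * (factor u i y * rowProd u x (i + 2) len) *
              rowProd u y (i + 1) (len + 1) := by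
            rw [cancel]; simp only [mul_assoc]
        _ = rowProd u x i (len + 1 + 1) * rowProd u y i (len + 1 + 1) := by
            rw [← c, e, e, e']; simp only [mul_assoc]

end NilCoxeter

/-! ### The nilCoxeter action on functions on the symmetric group -/

section

variable {n : ℕ}

theorem isAscent_mulSimple_of_add_two_le (w : Equiv.Perm (Fin n)) {i j : ℕ}
    (h : i + 2 ≤ j ∨ j + 2 ≤ i) : IsAscent (mulSimple w j) i ↔ IsAscent w i := by
  by_cases hi : i + 1 < n
  · rw [isAscent_iff _ hi, isAscent_iff _ hi,
      mulSimple_apply_of_ne _ (by simp; omega) (by simp; omega),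
      mulSimple_apply_of_ne _ (by simp; omega) (by simp; omega)]
  · exact ⟨fun h => absurd h.lt hi, fun h => absurd h.lt hi⟩

theorem mulSimple_apply (w : Equiv.Perm (Fin n)) {m : ℕ} (h : m + 1 < n) (i : Fin n) :
    mulSimple w m i = if i.val = m then w ⟨m + 1, h⟩ else
      if i.val = m + 1 then w ⟨m, Nat.lt_of_succ_lt h⟩ else w i := by
  split_ifs with h1 h2
  · subst h1; exact mulSimple_apply_left w h
  · have : i = ⟨m + 1, h⟩ := Fin.ext h2
    rw [this, mulSimple_apply_right w h]
  · exact mulSimple_apply_of_ne w h1 h2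

theorem mulSimple_comm (w : Equiv.Perm (Fin n)) {i j : ℕ} (h : i + 2 ≤ j) :
    mulSimple (mulSimple w i) j = mulSimple (mulSimple w j) i := by
  by_cases hj : j + 1 < n
  · have hi : i + 1 < n := by omega
    refine Equiv.ext fun x => ?_
    simp only [mulSimple_apply _ hi, mulSimple_apply _ hj]
    split_ifs <;> first | rfl | omega
  · simp [mulSimple, hj]

theorem mulSimple_braid (w : Equiv.Perm (Fin n)) {i : ℕ} (h : i + 2 < n) :
    mulSimple (mulSimple (mulSimple w i) (i + 1)) i =
      mulSimple (mulSimple (mulSimple w (i + 1)) i) (i + 1) := by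
  have hi : i + 1 < n := by omega
  refine Equiv.ext fun x => ?_
  simp only [mulSimple_apply _ hi, mulSimple_apply _ (show i + 1 + 1 < n from h)]
  split_ifs <;> first | rfl | omega

open Classical in
/-- The right action of the generator `u_m` of the nilCoxeter algebra: `F u_m` has the value
`F (w s_m)` at `w` if `w s_m < w`, and `0` otherwise. -/
noncomputable def nilOp (n m : ℕ) :
    Module.End (MvPolynomial ℕ ℤ) (Equiv.Perm (Fin n) → MvPolynomial ℕ ℤ) where
  toFun F w := if IsAscent (mulSimple w m) m then F (mulSimple w m) else 0
  map_add' F G := by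
    funext w
    simp only [Pi.add_apply]
    split_ifs <;> simp
  map_smul' r F := by
    funext w
    simp only [Pi.smul_apply, RingHom.id_apply]
    split_ifs <;> simp

open Classical in
theorem nilOp_apply (m : ℕ) (F : Equiv.Perm (Fin n) → MvPolynomial ℕ ℤ) (w : Equiv.Perm (Fin n)) :
    nilOp n m F w = if IsAscent (mulSimple w m) m then F (mulSimple w m) else 0 := rfl

theorem isNilCoxeter_nilOp : IsNilCoxeter (nilOp n) where
  sq i := by
    refine LinearMap.ext fun F => funext fun w => ?_
    simp only [Module.End.mul_apply, nilOp_apply, mulSimple_mulSimple, LinearMap.zero_apply,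
      Pi.zero_apply]
    split_ifs with h1 h2
    · exact absurd h1 ((isAscent_mulSimple _ h1.lt).1 h2)
    · rfl
    · rfl
  comm i j h := by
    refine LinearMap.ext fun F => funext fun w => ?_
    have e1 : IsAscent (mulSimple (mulSimple w j) i) j ↔ IsAscent (mulSimple w j) j :=
      isAscent_mulSimple_of_add_two_le _ (Or.inr h)
    have e2 : IsAscent (mulSimple (mulSimple w j) i) i ↔ IsAscent (mulSimple w i) i := by
      rw [← mulSimple_comm w h, isAscent_mulSimple_of_add_two_le _ (Or.inl h)]
    simp only [Module.End.mul_apply, nilOp_apply]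
    by_cases h1 : IsAscent (mulSimple w i) i <;> by_cases h2 : IsAscent (mulSimple w j) j <;>
      simp [e1, e2, h1, h2, mulSimple_comm w h]
  braid i := by
    refine LinearMap.ext fun F => funext fun w => ?_
    simp only [Module.End.mul_apply, nilOp_apply]
    by_cases h : i + 2 < n
    · have hi : i + 1 < n := by omega
      have hi' : i + 1 + 1 < n := h
      rw [mulSimple_braid w h]
      simp only [isAscent_iff _ hi, isAscent_iff _ hi', mulSimple_apply _ hi, mulSimple_apply _ hi']
      have ne1 : i ≠ i + 1 + 1 := by omega
      have ne2 : i + 1 + 1 ≠ i := by omega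
      simp [ne1, ne2]
      split_ifs <;> rfl
    · have h1 : ∀ w : Equiv.Perm (Fin n), ¬ IsAscent w (i + 1) := fun w h' => h h'.lt
      simp [h1]

theorem factor_nilOp_apply (m : ℕ) (x : MvPolynomial ℕ ℤ)
    (F : Equiv.Perm (Fin n) → MvPolynomial ℕ ℤ) (w : Equiv.Perm (Fin n)) :
    factor (nilOp n) m x F w = F w + x * nilOp n m F w := by
  simp [factor]

/-! ### The generating function of reduced pipe dreams -/

/-- The generating function, as a function on the symmetric group, of the reduced subwords of the
first `a` rows of the staircase. -/
noncomputable def pipeSum (n : ℕ) : ℕ → Equiv.Perm (Fin n) → MvPolynomial ℕ ℤ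
  | 0 => Pi.single 1 1
  | a + 1 => rowProd (nilOp n) (X a : MvPolynomial ℕ ℤ) a (n - 1 - a) (pipeSum n a)

/-- Endomorphisms compose from the right, so the increasing product `rowProd` applies the largest
letter first, in agreement with reading rows from right to left. -/
theorem foldl_rowCells (a i len : ℕ) (F : Equiv.Perm (Fin n) → MvPolynomial ℕ ℤ) :
    (rowCells a i len).foldl
      (fun F c => factor (nilOp n) c.2 (X c.1 : MvPolynomial ℕ ℤ) F) F =
      rowProd (nilOp n) (X a : MvPolynomial ℕ ℤ) i len F := by
  induction len generalizing i with
  | zero => rfl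
  | succ len ih =>
    rw [rowCells, List.foldl_append, ih]
    rfl

theorem pipeSum_eq_foldl (a : ℕ) : pipeSum n a =
    (cells n a).foldl (fun F c => factor (nilOp n) c.2 (X c.1 : MvPolynomial ℕ ℤ) F)
      (Pi.single 1 1) := by
  induction a with
  | zero => rfl
  | succ a ih => rw [cells, List.foldl_append, ← ih, foldl_rowCells, pipeSum]

open Classical in
/-- The reduced subwords for `w` of the list `L` of cells. -/
noncomputable def reducedSubwords (L : List (ℕ × ℕ)) (w : Equiv.Perm (Fin n)) :
    Finset (Finset (ℕ × ℕ)) :=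
  L.toFinset.powerset.filter fun D => demazureProd n L D = w ∧ D.card = length w

theorem mem_reducedSubwords {L : List (ℕ × ℕ)} {w : Equiv.Perm (Fin n)} {D : Finset (ℕ × ℕ)} :
    D ∈ reducedSubwords L w ↔
      D ⊆ L.toFinset ∧ demazureProd n L D = w ∧ D.card = length w := by
  simp [reducedSubwords]

theorem reducedSubwords_nil_one : reducedSubwords [] (1 : Equiv.Perm (Fin n)) = {∅} := by
  ext D
  rw [mem_reducedSubwords, demazureProd_nil, length_one]
  simp only [List.toFinset_nil, Finset.subset_empty, true_and, Finset.card_eq_zero, and_self,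
    Finset.mem_singleton]

theorem reducedSubwords_nil_of_ne {w : Equiv.Perm (Fin n)} (h : w ≠ 1) :
    reducedSubwords [] w = ∅ := by
  ext D
  simp [mem_reducedSubwords, demazureProd_nil, h.symm]

-- The combinatorial counterpart of the factor `1 + x u_m`: a reduced subword for `w` either omits
-- `c`, or consists of `c` and a reduced subword for `w s_m < w`.
open Classical in
theorem reducedSubwords_append {L : List (ℕ × ℕ)} {c : ℕ × ℕ} (hL : (L ++ [c]).Nodup)
    (w : Equiv.Perm (Fin n)) :
    reducedSubwords (L ++ [c]) w = reducedSubwords L w ∪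
      if IsAscent (mulSimple w c.2) c.2 then (reducedSubwords L (mulSimple w c.2)).image (insert c)
      else ∅ := by
  have hc := notMem_of_nodup_append hL
  ext D
  rw [Finset.mem_union]
  by_cases hD : c ∈ D
  · have h1 : D ∉ reducedSubwords L w := fun h =>
      hc (by simpa using (mem_reducedSubwords.1 h).1 hD)
    simp only [h1, false_or]
    constructor
    · intro h
      obtain ⟨h2, h3, h4⟩ := mem_reducedSubwords.1 h
      rw [demazureProd_append_of_mem _ hD] at h3
      have h5 := erase_subset_toFinset h2
      have h6 := length_demazureProd_le (n := n) (List.nodup_append.1 hL).1 h5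
      rw [demazureProd_erase hc] at h6
      have h7 := Finset.card_erase_add_one hD
      by_cases ha : IsAscent (demazureProd n L D) c.2
      · rw [demazure_of_isAscent ha] at h3
        have h8 := length_mulSimple ha
        rw [h3] at h8
        have h9 : mulSimple w c.2 = demazureProd n L D := by rw [← h3, mulSimple_mulSimple]
        rw [h9, if_pos ha, Finset.mem_image]
        refine ⟨D.erase c, mem_reducedSubwords.2 ⟨h5, demazureProd_erase hc D, by omega⟩,
          Finset.insert_erase hD⟩
      -- Here `c` would be redundant: `D` without `c` still gives `w` but has fewer than `ℓ(w)`
      -- cells.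
      · rw [demazure_of_not_isAscent ha] at h3
        rw [h3] at h6
        omega
    · intro h
      split_ifs at h with ha
      · obtain ⟨D', h', rfl⟩ := Finset.mem_image.1 h
        obtain ⟨h2, h3, h4⟩ := mem_reducedSubwords.1 h'
        have hcD : c ∉ D' := fun h => hc (by simpa using h2 h)
        refine mem_reducedSubwords.2 ⟨?_, ?_, ?_⟩
        · refine Finset.insert_subset (by simp) (h2.trans ?_)
          simp [List.toFinset_append]
        · rw [demazureProd_append_of_mem _ (Finset.mem_insert_self _ _), demazureProd_insert hc,
            h3, demazure_of_isAscent ha, mulSimple_mulSimple]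
        · rw [Finset.card_insert_of_notMem hcD, h4, length_mulSimple_of_descent ha]
      · simp at h
  · have h1 : D ∉ (if IsAscent (mulSimple w c.2) c.2 then
        (reducedSubwords L (mulSimple w c.2)).image (insert c) else ∅) := by
      split_ifs
      · intro h
        obtain ⟨D', -, rfl⟩ := Finset.mem_image.1 h
        exact hD (Finset.mem_insert_self _ _)
      · simp
    simp only [h1, or_false]
    rw [mem_reducedSubwords, mem_reducedSubwords, demazureProd_append_of_notMem _ hD]
    refine and_congr_left fun _ => ⟨fun h => ?_, fun h => h.trans (by simp [List.toFinset_append])⟩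
    have := erase_subset_toFinset h
    rwa [Finset.erase_eq_of_notMem hD] at this

theorem foldl_factor_apply {L : List (ℕ × ℕ)} (hL : L.Nodup) (w : Equiv.Perm (Fin n)) :
    L.foldl (fun F c => factor (nilOp n) c.2 (X c.1 : MvPolynomial ℕ ℤ) F) (Pi.single 1 1) w =
      ∑ D ∈ reducedSubwords L w, ∏ c ∈ D, X c.1 := by
  induction L using List.reverseRecOn generalizing w with
  | nil =>
    rw [List.foldl_nil]
    by_cases h : w = 1
    · rw [h, reducedSubwords_nil_one]
      simp
    · rw [reducedSubwords_nil_of_ne h, Pi.single_eq_of_ne h]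
      simp
  | append_singleton L c ih =>
    have hc := notMem_of_nodup_append hL
    have ih := ih (List.nodup_append.1 hL).1
    have hcD : ∀ v : Equiv.Perm (Fin n), ∀ D ∈ reducedSubwords L v, c ∉ D := fun v D hD h =>
      hc (by simpa using (mem_reducedSubwords.1 hD).1 h)
    rw [List.foldl_append, List.foldl_cons, List.foldl_nil, factor_nilOp_apply, nilOp_apply,
      reducedSubwords_append hL, ih, ih]
    split_ifs with ha
    · rw [Finset.sum_union, Finset.sum_image, Finset.mul_sum]
      · congr 1
        refine Finset.sum_congr rfl fun D hD => ?_
        rw [Finset.prod_insert (hcD _ D hD)]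
      · intro D hD D' hD' e
        rw [← Finset.erase_insert (hcD _ D hD), ← Finset.erase_insert (hcD _ D' hD')]
        exact congrArg (fun D => D.erase c) e
      · rw [Finset.disjoint_left]
        intro D hD h
        obtain ⟨D', -, rfl⟩ := Finset.mem_image.1 h
        exact hcD _ _ hD (Finset.mem_insert_self _ _)
    · simp

theorem pipeSum_apply (w : Equiv.Perm (Fin n)) :
    pipeSum n n w = ∑ D ∈ reducedPipeDreams w, ∏ c ∈ D, X c.1 := by
  rw [pipeSum_eq_foldl, foldl_factor_apply (nodup_cells n n), reducedSubwords, toFinset_cells,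
    reducedPipeDreams]

/-! ### Divided differences of the generating function -/

/-- The exchange of the variables `x_i` and `x_{i+1}` in each value of a function. -/
noncomputable def swapFun (i : ℕ) (F : Equiv.Perm (Fin n) → MvPolynomial ℕ ℤ) :
    Equiv.Perm (Fin n) → MvPolynomial ℕ ℤ := fun w => swapVars i (F w)

theorem swapVars_X_left (i : ℕ) : swapVars i (X i) = X (i + 1) := by simp [swapVars]

theorem swapVars_X_right (i : ℕ) : swapVars i (X (i + 1)) = X i := by simp [swapVars]

theorem swapVars_X_of_ne {i a : ℕ} (h : a ≠ i) (h' : a ≠ i + 1) : swapVars i (X a) = X a := by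
  simp [swapVars, Equiv.swap_apply_of_ne_of_ne h h']

theorem swapFun_factor (i m : ℕ) (x : MvPolynomial ℕ ℤ)
    (F : Equiv.Perm (Fin n) → MvPolynomial ℕ ℤ) :
    swapFun i (factor (nilOp n) m x F) = factor (nilOp n) m (swapVars i x) (swapFun i F) := by
  funext w
  simp only [swapFun, factor_nilOp_apply, nilOp_apply, swapVars, map_add, map_mul]
  split_ifs <;> simp

theorem swapFun_rowProd (i : ℕ) (x : MvPolynomial ℕ ℤ) (j len : ℕ)
    (F : Equiv.Perm (Fin n) → MvPolynomial ℕ ℤ) :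
    swapFun i (rowProd (nilOp n) x j len F) =
      rowProd (nilOp n) (swapVars i x) j len (swapFun i F) := by
  induction len generalizing j with
  | zero => rfl
  | succ len ih =>
    simp only [rowProd, Module.End.mul_apply]
    rw [swapFun_factor, ih]

theorem swapFun_pipeSum {i a : ℕ} (h : a ≤ i) : swapFun i (pipeSum n a) = pipeSum n a := by
  induction a with
  | zero =>
    funext w
    by_cases hw : w = 1
    · simp [swapFun, pipeSum, hw, swapVars]
    · simp [swapFun, pipeSum, hw, swapVars]
  | succ a ih =>
    rw [pipeSum, swapFun_rowProd, ih (by omega), swapVars_X_of_ne (by omega) (by omega)]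

/-- Rows before `i` are free of `x_i` and `x_{i+1}`, and rows after `i + 1` use only letters that
commute with `u_i`. The two rows between are `(1 - y u_i) K` with `K` symmetric in `x = x_i` and `y
= x_{i+1}`. The difference is therefore `(x - y) u_i K`, and `u_i² = 0` allows `K` to be replaced by
the generating function itself. -/
theorem pipeSum_sub_swapFun {i : ℕ} (hi : i + 1 < n) (j : ℕ) :
    pipeSum n (i + 2 + j) - swapFun i (pipeSum n (i + 2 + j)) =
      (X i - X (i + 1) : MvPolynomial ℕ ℤ) • nilOp n i (pipeSum n (i + 2 + j)) := by
  have hu := isNilCoxeter_nilOp (n := n)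
  induction j with
  | zero =>
    obtain ⟨len, hlen⟩ : ∃ len, n = i + 2 + len := ⟨n - (i + 2), by omega⟩
    set x : MvPolynomial ℕ ℤ := X i
    set y : MvPolynomial ℕ ℤ := X (i + 1)
    set K := rowProd (nilOp n) y i (len + 1) (rowProd (nilOp n) x i (len + 1) (pipeSum n i))
      with hK
    have h1 : pipeSum n (i + 2 + 0) = factor (nilOp n) i (-y) K := by
      have e1 : n - 1 - i = len + 1 := by omega
      have e2 : n - 1 - (i + 1) = len := by omega
      have e3 : pipeSum n (i + 2 + 0) = rowProd (nilOp n) y (i + 1) len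
          (rowProd (nilOp n) x i (len + 1) (pipeSum n i)) := by
        show rowProd (nilOp n) y (i + 1) (n - 1 - (i + 1))
          (rowProd (nilOp n) x i (n - 1 - i) (pipeSum n i)) = _
        rw [e1, e2]
      -- Row `i + 1` of the staircase begins at letter `i + 1`; supplying the missing letter `i` and
      -- cancelling it makes both rows equally long, so that `rowProd_comm` applies.
      have e4 : factor (nilOp n) i (-y) * rowProd (nilOp n) y i (len + 1) =
          rowProd (nilOp n) y (i + 1) len := by
        rw [rowProd, ← mul_assoc, hu.factor_mul_factor, neg_add_cancel, factor_zero, one_mul]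
      rw [e3, hK, ← Module.End.mul_apply (factor _ _ _), e4]
    have h2 : swapFun i K = K := by
      rw [hK, swapFun_rowProd, swapFun_rowProd, swapFun_pipeSum le_rfl, swapVars_X_left,
        swapVars_X_right, ← Module.End.mul_apply, ← Module.End.mul_apply, hu.rowProd_comm]
    have h3 : swapVars i (-y) = -x := by
      have : swapVars i (-y) = -swapVars i y := by simp only [swapVars, map_neg]
      rw [this, swapVars_X_right]
    have h4 : nilOp n i (nilOp n i K) = 0 := by
      rw [← Module.End.mul_apply, hu.sq]; rfl
    rw [h1, swapFun_factor, h2, h3]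
    simp only [factor, LinearMap.add_apply, LinearMap.smul_apply, map_add, map_smul, h4,
      Module.End.one_apply]
    module
  | succ j ih =>
    have h1 : pipeSum n (i + 2 + (j + 1)) = rowProd (nilOp n) (X (i + 2 + j) : MvPolynomial ℕ ℤ)
      (i + 2 + j) (n - 1 - (i + 2 + j)) (pipeSum n (i + 2 + j)) := rfl
    rw [h1, swapFun_rowProd, swapVars_X_of_ne (by omega) (by omega), ← map_sub, ih, map_smul,
      ← Module.End.mul_apply, ← (hu.commute_rowProd (by omega) _ _).eq, Module.End.mul_apply]

/-- `divDiff` is a chosen quotient; in a domain the choice is unique. -/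
theorem divDiff_eq {i : ℕ} {f g : MvPolynomial ℕ ℤ}
    (h : f - swapVars i f = (X i - X (i + 1)) * g) : divDiff i f = g := by
  have hne : (X i - X (i + 1) : MvPolynomial ℕ ℤ) ≠ 0 := by
    rw [sub_ne_zero]
    intro e
    have := MvPolynomial.X_injective e
    omega
  exact mul_left_cancel₀ hne ((divDiff_spec i f).symm.trans h)

theorem divDiff_pipeSum {w : Equiv.Perm (Fin n)} {i : ℕ} (h : IsAscent w i) :
    divDiff i (pipeSum n n (mulSimple w i)) = pipeSum n n w := by
  refine divDiff_eq ?_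
  have := h.lt
  obtain ⟨j, hj⟩ : ∃ j, n = i + 2 + j := ⟨n - (i + 2), by omega⟩
  have h1 := congrFun (pipeSum_sub_swapFun this j) (mulSimple w i)
  rw [← hj] at h1
  rw [Pi.smul_apply, nilOp_apply, mulSimple_mulSimple, if_pos h] at h1
  exact h1

theorem prod_staircase :
    ∏ c ∈ staircase n, (X c.1 : MvPolynomial ℕ ℤ) = ∏ j : Fin n, X j.val ^ (n - 1 - j.val) := by
  rw [Fin.prod_univ_eq_prod_range (fun j => (X j : MvPolynomial ℕ ℤ) ^ (n - 1 - j)) n, staircase,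
    Finset.prod_filter, Finset.prod_product]
  refine Finset.prod_congr rfl fun a ha => ?_
  rw [← Finset.prod_filter]
  refine (Finset.prod_const (X a : MvPolynomial ℕ ℤ)).trans (congrArg _ ?_)
  have : (Finset.range n).filter (fun m => a ≤ m ∧ m + 1 < n) = Finset.Ico a (n - 1) := by
    ext m
    simp only [Finset.mem_filter, Finset.mem_range, Finset.mem_Ico]
    omega
  exact (congrArg Finset.card this).trans (Nat.card_Ico _ _)

/-- The pipe dream formula for Schubert polynomials. -/
theorem schubert_eq_sum (w : Equiv.Perm (Fin n)) :
    schubert w = ∑ D ∈ reducedPipeDreams w, ∏ c ∈ D, X c.1 := by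
  rw [← pipeSum_apply]
  -- The induction follows the termination measure of `schubert`.
  induction hk : ∑ j : Fin n, j.val * (w j).val using Nat.strong_induction_on generalizing w with
  | _ k ih =>
    subst hk
    classical
    rw [schubert]
    split_ifs with h
    · rw [ih _ (mulSimple_measure w _ (Nat.find_spec h)) _ rfl, divDiff_pipeSum (Nat.find_spec h)]
    · rw [pipeSum_apply, reducedPipeDreams_of_forall_not_isAscent fun m hm => h ⟨m, hm⟩,
        Finset.sum_singleton, prod_staircase]

end

/-! ### Grassmannian permutations in the Bruhat order -/

/-- The index of the antidiagonal of the grid which contains a box of the shape with bottom row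
`d - 1`. -/
def boxLetter (d : ℕ) (c : ℕ × ℕ) : ℕ := d - 1 - c.1 + c.2

section

variable {n : ℕ}

theorem rank_add_of_forall_lt (w : Equiv.Perm (Fin n)) {a t x : ℕ} (ht : a + t ≤ n)
    (h : ∀ i : Fin n, a ≤ i.val → i.val < a + t → (w i).val < x) :
    rank w (a + t) x = rank w a x + t := by
  induction t with
  | zero => simp
  | succ t ih =>
    rw [← add_assoc, rank_succ w (by omega), if_pos (h _ (Nat.le_add_right a t) (Nat.lt_succ_self _)),
      ih (by omega) fun i h1 h2 => h i h1 (by omega)]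
    push_cast
    ring

theorem rank_add_of_forall_le (w : Equiv.Perm (Fin n)) {a t x : ℕ} (ht : a + t ≤ n)
    (h : ∀ i : Fin n, a ≤ i.val → i.val < a + t → x ≤ (w i).val) :
    rank w (a + t) x = rank w a x := by
  induction t with
  | zero => simp
  | succ t ih =>
    rw [← add_assoc, rank_succ w (by omega), if_neg (not_lt.2
      (h _ (Nat.le_add_right a t) (Nat.lt_succ_self _))),
      ih (by omega) fun i h1 h2 => h i h1 (by omega), add_zero]

/-- A permutation `w` is above `u`, increasing on `[0, d)` and on `[d, n)`, as soon as the ranks in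
row `d` are. -/
theorem le_of_rank_row_le {u w : Equiv.Perm (Fin n)} {d : ℕ} (hd : d ≤ n)
    (hu : ∀ i j : Fin n, i < j → (j.val < d ∨ d ≤ i.val) → u i < u j)
    (h : ∀ x ≤ n, rank w d x ≤ rank u d x) : permASM u ≤ permASM w := by
  rw [permASM_le_iff]
  intro p x
  rw [← rank_min_left, ← rank_min_right, ← rank_min_left u, ← rank_min_right u]
  have hp : min p n ≤ n := min_le_right _ _
  have hx : min x n ≤ n := min_le_right _ _
  generalize min p n = p at *
  generalize min x n = x at *
  rcases le_or_gt p d with hpd | hpd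
  · by_cases hall : ∀ i : Fin n, 0 ≤ i.val → i.val < 0 + p → (u i).val < x
    · have h1 := rank_add_of_forall_lt u (by omega) hall
      rw [zero_add, rank_zero_left, zero_add] at h1
      rw [h1]
      exact rank_le_left _ _ _
    · push Not at hall
      obtain ⟨i, -, h1, h2⟩ := hall
      -- Since `u` increases on `[0, d)`, no position from `i` to `d` counts, so the rank of `u` is
      -- constant between rows `i` and `d`.
      have h3 := rank_add_of_forall_le u (a := i) (t := d - i) (x := x) (by omega) fun j h4 h5 => by
        rcases eq_or_lt_of_le (show i ≤ j from h4) with rfl | h6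
        · exact h2
        · exact h2.trans (Fin.lt_def.1 (hu i j h6 (Or.inl (by omega)))).le
      rw [show i.val + (d - i) = d by omega] at h3
      calc rank w p x ≤ rank w d x := rank_mono w hpd le_rfl
        _ ≤ rank u d x := h x hx
        _ = rank u i x := h3
        _ ≤ rank u p x := rank_mono u (by omega) le_rfl
  · obtain ⟨t, rfl⟩ : ∃ t, p = d + t := ⟨p - d, by omega⟩
    by_cases hall : ∀ i : Fin n, d ≤ i.val → i.val < d + t → (u i).val < x
    · rw [rank_add_of_forall_lt u hp hall]
      have h1 := rank_add_le w d t x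
      have h2 := h x hx
      linarith
    · push Not at hall
      obtain ⟨i, h0, h1, h2⟩ := hall
      have h3 := rank_add_of_forall_le u (a := i) (t := n - i) (x := x) (by omega) fun j h4 h5 => by
        rcases eq_or_lt_of_le (show i ≤ j from h4) with rfl | h6
        · exact h2
        · exact h2.trans (Fin.lt_def.1 (hu i j h6 (Or.inr h0))).le
      rw [show i.val + (n - i) = n by omega] at h3
      have h4 : rank u n x = x := by rw [← rank_inv, rank_top _ hx]
      calc rank w (d + t) x ≤ x := rank_le_right _ _ _
        _ = rank u i x := by rw [← h3, h4]
        _ ≤ rank u (d + t) x := rank_mono u (by omega) le_rfl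

theorem lt_of_mem_of_colLen_le {μ : YoungDiagram} {d : ℕ} (hl : μ.colLen 0 ≤ d) {c : ℕ × ℕ}
    (hc : c ∈ μ) : c.1 < d := by
  have h1 : c.1 < μ.colLen c.2 := YoungDiagram.mem_iff_lt_colLen.1 hc
  have h2 := μ.colLen_anti 0 c.2 (Nat.zero_le _)
  omega

/-- The tableau criterion for the Bruhat order, split into boxes. The box `(p, q)` demands that at
least `p + 1` of the first `d` values of `w` exceed its letter; the last box of row `p` bounds the
`(p + 1)`-st largest of these values from below by the corresponding value of `u`. -/
theorem grassmannian_le_iff (μ : YoungDiagram) (d : ℕ) (hl : μ.colLen 0 ≤ d)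
    (hn : d + μ.rowLen 0 ≤ n) (w : Equiv.Perm (Fin n)) :
    permASM (grassmannian n μ d hl hn) ≤ permASM w ↔
      ∀ c ∈ μ, rank w d (boxLetter d c + 1) + c.1 < d := by
  set u := grassmannian n μ d hl hn with hu
  have val : ∀ i : Fin n, (u i).val = grassFun μ d i := fun i => rfl
  have mono : ∀ i j : Fin n, i < j → (j.val < d ∨ d ≤ i.val) → u i < u j := by
    intro i j hij h
    rw [Fin.lt_def, val, val]
    rcases h with h | h
    · exact grassFun_lt_left μ hij h
    · exact grassFun_lt_right μ hl h hij
  constructor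
  · intro h c hc
    have hcd := lt_of_mem_of_colLen_le hl hc
    have hcr : c.2 < μ.rowLen c.1 := YoungDiagram.mem_iff_lt_rowLen.1 hc
    have h1 := permASM_le_iff.1 h d (boxLetter d c + 1)
    have h2 := rank_add_of_forall_le u (a := d - 1 - c.1) (t := c.1 + 1) (x := boxLetter d c + 1)
      (by omega) fun i h3 h4 => by
        have h5 := μ.rowLen_anti (d - 1 - i) c.1 (by omega)
        rw [val, grassFun, if_pos (by omega), boxLetter]
        omega
    rw [show d - 1 - c.1 + (c.1 + 1) = d by omega] at h2
    have h3 := rank_le_left u (d - 1 - c.1) (boxLetter d c + 1)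
    omega
  · intro h
    refine le_of_rank_row_le (by omega) mono fun x hx => ?_
    by_cases hall : ∀ i : Fin n, 0 ≤ i.val → i.val < 0 + d → (u i).val < x
    · have h1 := rank_add_of_forall_lt u (by omega) hall
      rw [zero_add, rank_zero_left, zero_add] at h1
      rw [h1]
      exact rank_le_left _ _ _
    · have hex : ∃ i : ℕ, ∃ hi : i < n, i < d ∧ x ≤ (u ⟨i, hi⟩).val := by
        push Not at hall
        obtain ⟨i, -, h1, h2⟩ := hall
        exact ⟨i, i.2, by omega, h2⟩
      classical
      obtain ⟨hi, hid, hix⟩ := Nat.find_spec hex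
      have hmin : ∀ j : Fin n, j.val < Nat.find hex → (u j).val < x := fun j hj => by
        by_contra hc
        exact Nat.find_min hex hj ⟨j.2, by omega, not_lt.1 hc⟩
      generalize Nat.find hex = i at *
      have h3 := rank_add_of_forall_lt u (a := 0) (t := i) (x := x) (by omega)
        fun j _ hj => hmin j (by omega)
      rw [zero_add, rank_zero_left, zero_add] at h3
      have h4 : (i : ℤ) ≤ rank u d x := by
        rw [← h3]
        exact rank_mono u hid.le le_rfl
      refine le_trans ?_ h4
      rcases le_or_gt x i with hxi | hxi
      · exact (rank_le_right w d x).trans (by exact_mod_cast hxi)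
      · rw [val, grassFun, if_pos hid] at hix
        -- The box of the row belonging to position `i` whose letter is `x - 1`; its condition says
        -- that the rank of `w` is at most `i`.
        have hc : (d - 1 - i, x - i - 1) ∈ μ :=
          YoungDiagram.mem_iff_lt_rowLen.2 (by simp only at hix; omega)
        have h5 := h _ hc
        rw [show boxLetter d (d - 1 - i, x - i - 1) + 1 = x by simp only [boxLetter]; omega] at h5
        simp only at h5
        omega

/-! ### Tableaux and pipe dreams -/

/-- For a box with letter `m` in row `p`, the two conditions on the right are those of its left
neighbour (letter `m - 1`, row `p`) and of the box below it (letter `m + 1`, row `p - 1`). Left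
multiplication by `s_m` thus adds a box once both neighbours are present. -/
theorem colOp_rank_add_lt_iff {w : Equiv.Perm (Fin n)} {d m p : ℕ} :
    colOp m (rank w) d (m + 1) + p < d ↔ rank w d m + p < d ∧ rank w d (m + 2) + p < d + 1 := by
  rw [colOp, if_pos rfl]
  omega

theorem mem_of_readBefore {pre L : List (ℕ × ℕ)} {b c : ℕ × ℕ} (h : cells n n = pre ++ b :: L)
    (hc : c ∈ staircase n) (hbc : ReadBefore b c) : c ∈ L := by
  have h1 : c ∈ pre ++ b :: L := h ▸ mem_cells_self.2 hc
  have h2 := pairwise_cells n n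
  rw [h, List.pairwise_append] at h2
  rcases List.mem_append.1 h1 with h3 | h3
  · have := h2.2.2 c h3 b (by simp)
    unfold ReadBefore at this hbc
    omega
  · rcases List.mem_cons.1 h3 with rfl | h4
    · unfold ReadBefore at hbc
      omega
    · exact h4

theorem colOp_rank_le (w : Equiv.Perm (Fin n)) (m p q : ℕ) :
    colOp m (rank w) p q ≤ rank w p q := by
  rw [colOp]
  split_ifs with h
  · have h1 := rank_le_succ_right w p m
    have h2 := rank_le_succ_right w p (m + 1)
    rw [h]
    rw [show m + 1 + 1 = m + 2 from rfl] at h2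
    omega
  · rfl

/-- Induction on final segments of the reading word. The left neighbour of a box has a label at
least as large and a smaller letter, and the box below has a strictly larger label; both cells are
read later, so their conditions hold when the cell of the box is prepended. On the border of the
shape, the trivial rank bounds replace the missing neighbour. -/
theorem rank_lt_of_tableau_subset {μ : YoungDiagram} {d : ℕ} (hl : μ.colLen 0 ≤ d)
    {T : μ.cells → Fin d} (hT : IsRSSYT μ d T) {D : Finset (ℕ × ℕ)} (hD : D ⊆ staircase n)
    (h : ∀ c : μ.cells, ((T c).val, boxLetter d c.1) ∈ D) :
    ∀ c ∈ μ, rank (demazureProd n (cells n n) D) d (boxLetter d c + 1) + c.1 < d := by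
  suffices key : ∀ L pre, cells n n = pre ++ L → ∀ c : μ.cells,
      ((T c).val, boxLetter d c.1) ∈ L →
      rank (demazureProd n L D) d (boxLetter d c.1 + 1) + c.1.1 < d from
    fun c hc => key _ [] rfl ⟨c, hc⟩ (mem_cells_self.2 (hD (h _)))
  intro L
  induction L with
  | nil => simp
  | cons b L ih =>
    intro pre hpre c hc
    have ih := ih (pre ++ [b]) (by simpa using hpre)
    have hlet : ∀ x ∈ b :: L, x.2 + 1 < n := fun x hx =>
      letter_lt_of_mem_cells (hpre ▸ List.mem_append_right _ hx)
    by_cases hb : b ∈ D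
    · rw [demazureProd_cons_of_mem L (hlet b (by simp)) (fun x hx => hlet x (by simp [hx])) hb,
        rank_demazureLeft _ (hlet b (by simp))]
      rcases List.mem_cons.1 hc with hcb | hcL
      · have hm : b.2 = boxLetter d c.1 := by rw [← hcb]
        have hcd := lt_of_mem_of_colLen_le hl c.2
        have hpq : c.1 = (c.1.1, c.1.2) := rfl
        rw [hm, colOp_rank_add_lt_iff]
        constructor
        · rcases hq : c.1.2 with _ | q
          · have h1 := rank_le_right (demazureProd n L D) d (boxLetter d c.1)
            have h2 : boxLetter d c.1 = d - 1 - c.1.1 := by rw [boxLetter, hq]; rfl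
            rw [h2] at h1 ⊢
            omega
          · have hc' : (c.1.1, q) ∈ μ := μ.up_left_mem le_rfl (by omega) (hpq ▸ c.2)
            have h1 := hT.row_weak ⟨_, hc'⟩ c rfl (by show q < c.1.2; omega)
            have h2 : boxLetter d c.1 = boxLetter d (c.1.1, q) + 1 := by
              simp only [boxLetter, hq]; omega
            have h3 := ih ⟨_, hc'⟩ (mem_of_readBefore hpre (hD (h _)) (by
              rw [← hcb]
              unfold ReadBefore
              simp only
              have := Fin.le_def.1 h1
              omega))
            rw [h2]
            exact h3
        · rcases hp : c.1.1 with _ | p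
          · have h1 := rank_le_left (demazureProd n L D) d (boxLetter d c.1 + 2)
            push_cast
            omega
          · have hc' : (p, c.1.2) ∈ μ := μ.up_left_mem (by omega) le_rfl (hpq ▸ c.2)
            have h1 := hT.col_strict ⟨_, hc'⟩ c rfl (by show p < c.1.1; omega)
            have h2 : boxLetter d c.1 + 1 = boxLetter d (p, c.1.2) := by
              simp only [boxLetter, hp]; omega
            have h3 := ih ⟨_, hc'⟩ (mem_of_readBefore hpre (hD (h _)) (by
              rw [← hcb]
              unfold ReadBefore
              simp only
              have := Fin.lt_def.1 h1
              omega))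
            rw [show boxLetter d c.1 + 2 = boxLetter d c.1 + 1 + 1 from rfl, h2]
            simp only at h3
            push_cast
            omega
      · have h1 := ih c hcL
        have h2 := colOp_rank_le (demazureProd n L D) b.2 d (boxLetter d c.1 + 1)
        omega
    · rw [demazureProd_cons_of_notMem L hb]
      refine ih c ((List.mem_cons.1 hc).resolve_left fun e => hb ?_)
      rw [← e]
      exact h c

/-- The converse construction: letters are prepended one by one, and each box is labelled by the row
of the cell at which its condition first becomes true. For the empty word no box satisfies its
condition. -/
theorem exists_box_labels {d : ℕ} (hd : d ≤ n) (D : Finset (ℕ × ℕ)) {L : List (ℕ × ℕ)}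
    (hL : L.Pairwise ReadBefore) (hlet : ∀ x ∈ L, x.2 + 1 < n) :
    ∃ f : ℕ × ℕ → ℕ,
      (∀ c : ℕ × ℕ, c.1 < d → rank (demazureProd n L D) d (boxLetter d c + 1) + c.1 < d →
        (f c, boxLetter d c) ∈ L ∧ (f c, boxLetter d c) ∈ D) ∧
      (∀ p q : ℕ, p < d → rank (demazureProd n L D) d (boxLetter d (p, q + 1) + 1) + p < d →
        f (p, q + 1) ≤ f (p, q)) ∧
      (∀ p q : ℕ, p + 1 < d →
        rank (demazureProd n L D) d (boxLetter d (p + 1, q) + 1) + (p + 1 : ℕ) < d →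
        f (p + 1, q) < f (p, q)) := by
  induction L with
  | nil =>
    have key : ∀ p q : ℕ, p < d →
        ¬ rank (demazureProd n [] D) d (boxLetter d (p, q) + 1) + p < d := by
      intro p q hp h
      rw [demazureProd_nil, rank_one] at h
      simp only [boxLetter] at h
      omega
    exact ⟨0, fun c hc h => absurd h (key _ _ hc), fun p q hp h => absurd h (key _ _ hp),
      fun p q hp h => absurd h (key _ _ hp)⟩
  | cons b L ih =>
    obtain ⟨f, hf1, hf2, hf3⟩ := ih hL.of_cons fun x hx => hlet x (by simp [hx])
    by_cases hb : b ∈ D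
    · rw [demazureProd_cons_of_mem L (hlet b (by simp)) (fun x hx => hlet x (by simp [hx])) hb,
        rank_demazureLeft _ (hlet b (by simp))]
      set w := demazureProd n L D
      have hbL : ∀ x ∈ L, ReadBefore b x := (List.pairwise_cons.1 hL).1
      classical
      have new : ∀ c : ℕ × ℕ, colOp b.2 (rank w) d (boxLetter d c + 1) + c.1 < d →
          ¬ rank w d (boxLetter d c + 1) + c.1 < d → boxLetter d c = b.2 := by
        intro c h1 h2
        by_contra hne
        rw [colOp, if_neg (by omega)] at h1
        exact h2 h1
      -- A newly satisfied box has the letter of `b`, and its neighbours to the left and below were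
      -- satisfied before; their cells are read after `b`, which gives the inequalities between
      -- labels.
      refine ⟨fun c => if rank w d (boxLetter d c + 1) + c.1 < d then f c else b.1, ?_, ?_, ?_⟩
      · intro c hc h
        by_cases h1 : rank w d (boxLetter d c + 1) + c.1 < d
        · simp only [h1, if_true]
          exact ⟨List.mem_cons_of_mem _ (hf1 c hc h1).1, (hf1 c hc h1).2⟩
        · simp only [h1, if_false]
          rw [new c h h1]
          exact ⟨by simp, hb⟩
      · intro p q hp h
        have hlt : boxLetter d (p, q + 1) = boxLetter d (p, q) + 1 := rfl
        by_cases h1 : rank w d (boxLetter d (p, q + 1) + 1) + p < d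
        · have h2 : rank w d (boxLetter d (p, q) + 1) + p < d := by
            rw [hlt] at h1
            have := (rank_le_succ_right w d (boxLetter d (p, q) + 1)).1
            omega
          simp only [h1, h2, if_true]
          exact hf2 p q hp h1
        · have h3 := new (p, q + 1) h h1
          rw [← h3, colOp_rank_add_lt_iff, hlt] at h
          simp only [h1, h.1, if_true, if_false]
          have h4 := hbL _ (hf1 (p, q) hp h.1).1
          unfold ReadBefore at h4
          simp only at h4
          omega
      · intro p q hp h
        have hlt : boxLetter d (p, q) = boxLetter d (p + 1, q) + 1 := by
          simp only [boxLetter]; omega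
        by_cases h1 : rank w d (boxLetter d (p + 1, q) + 1) + (p + 1 : ℕ) < d
        · have h2 : rank w d (boxLetter d (p, q) + 1) + p < d := by
            rw [hlt]
            have := (rank_le_succ_right w d (boxLetter d (p + 1, q) + 1)).2
            push_cast at h1
            omega
          simp only [h1, h2, if_true]
          exact hf3 p q hp h1
        · have h3 := new (p + 1, q) h h1
          rw [← h3, colOp_rank_add_lt_iff] at h
          have h2 : rank w d (boxLetter d (p, q) + 1) + p < d := by
            rw [hlt]
            have := h.2
            push_cast at this
            rw [show boxLetter d (p + 1, q) + 1 + 1 = boxLetter d (p + 1, q) + 2 from rfl]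
            omega
          simp only [h1, h2, if_true, if_false]
          have h4 := hbL _ (hf1 (p, q) (by omega) h2).1
          unfold ReadBefore at h4
          simp only [hlt, ← h3] at h4
          omega
    · rw [demazureProd_cons_of_notMem L hb]
      exact ⟨f, fun c hc h => ⟨List.mem_cons_of_mem _ (hf1 c hc h).1, (hf1 c hc h).2⟩, hf2, hf3⟩

theorem exists_tableau_subset {μ : YoungDiagram} {d : ℕ} (hl : μ.colLen 0 ≤ d) (hd : d ≤ n)
    {D : Finset (ℕ × ℕ)}
    (h : ∀ c ∈ μ, rank (demazureProd n (cells n n) D) d (boxLetter d c + 1) + c.1 < d) :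
    ∃ T : μ.cells → Fin d, IsRSSYT μ d T ∧ ∀ c : μ.cells, ((T c).val, boxLetter d c.1) ∈ D := by
  obtain ⟨f, hf1, hf2, hf3⟩ := exists_box_labels hd D (pairwise_cells n n)
    (fun c => letter_lt_of_mem_cells)
  have row : ∀ t p q, (p, q + t) ∈ μ → f (p, q + t) ≤ f (p, q) := by
    intro t
    induction t with
    | zero => intro p q _; rfl
    | succ t ih =>
      intro p q hm
      refine (hf2 p (q + t) (lt_of_mem_of_colLen_le hl hm) (h _ hm)).trans ?_
      exact ih p q (μ.up_left_mem le_rfl (by omega) hm)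
  have col : ∀ t p q, (p + t + 1, q) ∈ μ → f (p + t + 1, q) < f (p, q) := by
    intro t
    induction t with
    | zero => intro p q hm; exact hf3 p q (lt_of_mem_of_colLen_le hl hm) (h _ hm)
    | succ t ih =>
      intro p q hm
      exact (hf3 (p + t + 1) q (lt_of_mem_of_colLen_le hl hm) (h _ hm)).trans
        (ih p q (μ.up_left_mem (by omega) le_rfl hm))
  -- Compare with column `0`: the cell of `(p, 0)` lies in the staircase, so its label is at most
  -- its letter `d - 1 - p`.
  have lt_d : ∀ c ∈ μ, f c < d := by
    rintro ⟨p, q⟩ hm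
    have hm' : (p, 0) ∈ μ := μ.up_left_mem le_rfl (Nat.zero_le _) hm
    have hp : p < d := lt_of_mem_of_colLen_le hl hm'
    have h1 := row q p 0 (by rwa [zero_add])
    have h2 := mem_staircase.1 (mem_cells_self.1 (hf1 (p, 0) hp (h _ hm')).1)
    rw [zero_add] at h1
    simp only [boxLetter] at h2
    omega
  refine ⟨fun c => ⟨f c.1, lt_d _ c.2⟩, ⟨?_, ?_⟩, fun c =>
    (hf1 c.1 (lt_of_mem_of_colLen_le hl c.2) (h _ c.2)).2⟩
  · rintro ⟨⟨p, q⟩, hc⟩ ⟨⟨p', q'⟩, hc'⟩ (rfl : p = p') (hq : q < q')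
    obtain ⟨t, rfl⟩ : ∃ t, q' = q + t := ⟨q' - q, by omega⟩
    exact Fin.le_def.2 (row t p q hc')
  · rintro ⟨⟨p, q⟩, hc⟩ ⟨⟨p', q'⟩, hc'⟩ (rfl : q = q') (hp : p < p')
    obtain ⟨t, rfl⟩ : ∃ t, p' = p + t + 1 := ⟨p' - p - 1, by omega⟩
    exact Fin.lt_def.2 (col t p q hc')

/-- A subset of the staircase contains the support of a tableau if and only if its Demazure product
is above the Grassmannian permutation. -/
theorem grassmannian_le_demazureProd_iff (μ : YoungDiagram) (d : ℕ) (hl : μ.colLen 0 ≤ d)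
    (hn : d + μ.rowLen 0 ≤ n) {D : Finset (ℕ × ℕ)} (hD : D ⊆ staircase n) :
    permASM (grassmannian n μ d hl hn) ≤ permASM (demazureProd n (cells n n) D) ↔
      ∃ T : RSSYT μ d, ∀ c : μ.cells, ((T.1 c).val, boxLetter d c.1) ∈ D := by
  rw [grassmannian_le_iff]
  constructor
  · intro h
    obtain ⟨T, h1, h2⟩ := exists_tableau_subset hl (by omega) h
    exact ⟨⟨T, h1⟩, h2⟩
  · rintro ⟨T, h⟩
    exact rank_lt_of_tableau_subset hl T.2 hD h

end

/-! ### Least upper bounds of permutations among alternating sign matrices -/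

section

variable {n : ℕ}

/-- A sequence with values in `{0, 1}` can only go up and down in turn. -/
theorem alternates_sub {s : ℕ → ℤ} (hs : ∀ j ≤ n, s j = 0 ∨ s j = 1) :
    Alternates fun j : Fin n => s (j + 1) - s j := by
  intro j j' hj h h' h0
  have hj' := Fin.lt_def.1 hj
  have key : ∀ t, j.val + 1 + t ≤ j'.val → s (j + 1 + t) = s (j + 1) := by
    intro t
    induction t with
    | zero => intro _; rfl
    | succ t ih =>
      intro ht
      have h1 : s (j + 1 + t + 1) - s (j + 1 + t) = 0 :=
        h0 ⟨j + 1 + t, by omega⟩ (Fin.lt_def.2 (by simp only; omega))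
          (Fin.lt_def.2 (by simp only; omega))
      rw [← ih (by omega), ← add_assoc]
      linarith
  have h1 := key (j' - (j + 1)) (by omega)
  rw [show j.val + 1 + (j'.val - (j + 1)) = j' by omega] at h1
  have h2 := hs j (by omega)
  have h3 := hs (j + 1) (by omega)
  have h4 := hs (j' + 1) (by omega)
  simp only at h h' ⊢
  omega

theorem sum_Iic_val (F : ℕ → ℤ) (j : Fin n) :
    ∑ l ∈ Finset.Iic j, F l = ∑ l ∈ Finset.range (j + 1), F l := by
  rw [Nat.range_succ_eq_Iic, ← Fin.map_valEmbedding_Iic, Finset.sum_map]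
  rfl

/-- The corner sum functions of alternating sign matrices, with index `0` for the empty corner. -/
structure IsCornerFun (n : ℕ) (r : ℕ → ℕ → ℤ) : Prop where
  zero_left : ∀ q, r 0 q = 0
  zero_right : ∀ p, r p 0 = 0
  top_left : ∀ p ≤ n, r p n = p
  top_right : ∀ q ≤ n, r n q = q
  step_left : ∀ p < n, ∀ q ≤ n, r p q ≤ r (p + 1) q ∧ r (p + 1) q ≤ r p q + 1
  step_right : ∀ p ≤ n, ∀ q < n, r p q ≤ r p (q + 1) ∧ r p (q + 1) ≤ r p q + 1

theorem isCornerFun_rank (w : Equiv.Perm (Fin n)) : IsCornerFun n (rank w) where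
  zero_left := rank_zero_left w
  zero_right := rank_zero_right w
  top_left _ hp := rank_top w hp
  top_right q hq := by rw [← rank_inv, rank_top _ hq]
  step_left p _ q _ := rank_le_succ_left w p q
  step_right p _ q _ := rank_le_succ_right w p q

theorem IsCornerFun.min {r s : ℕ → ℕ → ℤ} (hr : IsCornerFun n r) (hs : IsCornerFun n s) :
    IsCornerFun n fun p q => min (r p q) (s p q) where
  zero_left q := by simp [hr.zero_left, hs.zero_left]
  zero_right p := by simp [hr.zero_right, hs.zero_right]
  top_left p hp := by simp [hr.top_left p hp, hs.top_left p hp]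
  top_right q hq := by simp [hr.top_right q hq, hs.top_right q hq]
  step_left p hp q hq := by
    have := hr.step_left p hp q hq
    have := hs.step_left p hp q hq
    omega
  step_right p hp q hq := by
    have := hr.step_right p hp q hq
    have := hs.step_right p hp q hq
    omega

/-- The entries are the mixed second differences of `r`. Along each row and column they are first
differences of a `0`/`1` sequence, hence alternate. -/
theorem IsCornerFun.exists_asm {r : ℕ → ℕ → ℤ} (hr : IsCornerFun n r) :
    ∃ A : ASM n, ∀ i j, cornerSum A i j = r (i + 1) (j + 1) := by
  have hrow : ∀ p < n, ∀ q ≤ n, r (p + 1) q - r p q = 0 ∨ r (p + 1) q - r p q = 1 :=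
    fun p hp q hq => by have := hr.step_left p hp q hq; omega
  have hcol : ∀ p ≤ n, ∀ q < n, r p (q + 1) - r p q = 0 ∨ r p (q + 1) - r p q = 1 :=
    fun p hp q hq => by have := hr.step_right p hp q hq; omega
  let g : ℕ → ℕ → ℤ := fun p q => (r (p + 1) (q + 1) - r p (q + 1)) - (r (p + 1) q - r p q)
  have hg : ∀ p q, g p q = (r (p + 1) (q + 1) - r (p + 1) q) - (r p (q + 1) - r p q) :=
    fun p q => by simp only [g]; ring
  refine ⟨⟨fun i j => g i j, ?_, ?_, ?_, ?_, ?_⟩, ?_⟩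
  · intro i j
    have h1 := hrow i i.2 j j.2.le
    have h2 := hrow i i.2 (j + 1) j.2
    simp only [g]
    omega
  · intro i
    exact alternates_sub (s := fun q => r (i + 1) q - r i q) (hrow i i.2)
  · intro j
    have h := alternates_sub (n := n) (s := fun p => r p (j + 1) - r p j) fun p hp => hcol p hp j j.2
    simpa only [hg] using h
  · intro i
    rw [Fin.sum_univ_eq_sum_range (fun q => g i q),
      Finset.sum_range_sub (fun q => r (i + 1) q - r i q), hr.top_left _ i.2,
      hr.top_left _ i.2.le, hr.zero_right, hr.zero_right]
    push_cast
    ring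
  · intro j
    rw [Fin.sum_univ_eq_sum_range (fun p => g p j)]
    simp only [hg]
    rw [Finset.sum_range_sub (fun p => r p (j + 1) - r p j), hr.top_right _ j.2,
      hr.top_right _ j.2.le, hr.zero_left, hr.zero_left]
    push_cast
    ring
  · intro i j
    have h1 : ∀ k : Fin n, ∑ l ∈ Finset.Iic j, g k l = r (k + 1) (j + 1) - r k (j + 1) := by
      intro k
      rw [sum_Iic_val (fun q => g k q), Finset.sum_range_sub (fun q => r (k + 1) q - r k q),
        hr.zero_right, hr.zero_right]
      ring
    show ∑ k ∈ Finset.Iic i, ∑ l ∈ Finset.Iic j, g k l = _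
    simp only [h1]
    rw [sum_Iic_val (fun p => r (p + 1) (j + 1) - r p (j + 1)),
      Finset.sum_range_sub (fun p => r p (j + 1)), hr.zero_left, sub_zero]

theorem Alternates.sum_Iic_le_one {f : Fin n → ℤ} (hf : Alternates f)
    (he : ∀ j, f j = -1 ∨ f j = 0 ∨ f j = 1) (j : Fin n) : ∑ l ∈ Finset.Iic j, f l ≤ 1 := by
  let P : ℕ → ℤ := fun m => ∑ l ∈ Finset.univ.filter fun l : Fin n => l.val < m, f l
  have hP : ∀ m (hm : m < n), P (m + 1) = f ⟨m, hm⟩ + P m := by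
    intro m hm
    have : (Finset.univ.filter fun l : Fin n => l.val < m + 1) =
        insert ⟨m, hm⟩ (Finset.univ.filter fun l : Fin n => l.val < m) := by
      ext l
      simp only [Finset.mem_filter, Finset.mem_univ, true_and, Finset.mem_insert, Fin.ext_iff]
      omega
    simp only [P]
    rw [this, Finset.sum_insert (by simp)]
  -- A partial sum is either `0` or equal to the last nonzero entry before it.
  have key : ∀ m ≤ n, (P m = 0 ∧ ∀ l : Fin n, l.val < m → f l = 0) ∨
      ∃ l : Fin n, l.val < m ∧ f l ≠ 0 ∧ (∀ x : Fin n, l < x → x.val < m → f x = 0) ∧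
        (P m = 0 ∨ P m = f l) := by
    intro m
    induction m with
    | zero => intro _; left; simp [P]
    | succ m ih =>
      intro hm
      have hm' : m < n := hm
      have hPm := hP m hm'
      have last : ∀ x : Fin n, x.val < m + 1 → x.val < m ∨ x = ⟨m, hm'⟩ := fun x hx => by
        rw [Fin.ext_iff]; simp only; omega
      by_cases h0 : f ⟨m, hm'⟩ = 0
      · rw [h0, zero_add] at hPm
        rw [hPm]
        rcases ih hm'.le with ⟨h1, h2⟩ | ⟨l, h1, h2, h3, h4⟩
        · refine Or.inl ⟨h1, fun x hx => ?_⟩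
          rcases last x hx with h | rfl
          exacts [h2 x h, h0]
        · refine Or.inr ⟨l, by omega, h2, fun x hlx hx => ?_, h4⟩
          rcases last x hx with h | rfl
          exacts [h3 x hlx h, h0]
      · refine Or.inr ⟨⟨m, hm'⟩, Nat.lt_succ_self _, h0, fun x hlx hx => ?_, ?_⟩
        · exact absurd (Fin.lt_def.1 hlx) (by simp only; omega)
        · rcases ih hm'.le with ⟨h1, -⟩ | ⟨l, h1, h2, h3, h4⟩
          · right; rw [hPm, h1, add_zero]
          · have h5 := hf l ⟨m, hm'⟩ (Fin.lt_def.2 h1) h2 h0 fun x hx hx' => h3 x hx hx'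
            rcases h4 with h4 | h4
            · right; rw [hPm, h4, add_zero]
            · left; rw [hPm, h4, h5]; ring
  have hj : ∑ l ∈ Finset.Iic j, f l = P (j + 1) := by
    refine Finset.sum_congr ?_ fun _ _ => rfl
    ext l
    simp only [Finset.mem_Iic, Finset.mem_filter, Finset.mem_univ, true_and, Fin.le_def,
      Nat.lt_succ_iff]
  rw [hj]
  rcases key (j + 1) j.2 with ⟨h1, -⟩ | ⟨l, -, -, -, h | h⟩
  · omega
  · omega
  · have := he l
    omega

theorem cornerSum_le_left (A : ASM n) (i j : Fin n) : cornerSum A i j ≤ i + 1 := by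
  have h1 : cornerSum A i j ≤ ∑ k ∈ Finset.Iic i, 1 :=
    Finset.sum_le_sum fun k _ => (A.2.row_alternates k).sum_Iic_le_one (A.2.entries k) j
  simpa using h1

theorem cornerSum_le_right (A : ASM n) (i j : Fin n) : cornerSum A i j ≤ j + 1 := by
  have h1 : cornerSum A i j ≤ ∑ l ∈ Finset.Iic j, 1 := by
    refine Finset.sum_comm.trans_le ?_
    exact Finset.sum_le_sum fun l _ =>
      (A.2.col_alternates l).sum_Iic_le_one (fun k => A.2.entries k l) i
  simpa using h1

/-- The identity is included so that the empty family is covered. This is harmless: by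
`cornerSum_le_left` and `cornerSum_le_right` it lies below every alternating sign matrix. -/
theorem exists_cornerFun_inf {ι : Type*} (u : ι → Equiv.Perm (Fin n)) (s : Finset ι) :
    ∃ r, IsCornerFun n r ∧ (∀ i ∈ s, ∀ p q, r p q ≤ rank (u i) p q) ∧
      ∀ p q, r p q = rank (1 : Equiv.Perm (Fin n)) p q ∨ ∃ i ∈ s, r p q = rank (u i) p q := by
  classical
  induction s using Finset.induction_on with
  | empty => exact ⟨_, isCornerFun_rank 1, by simp, by simp⟩
  | insert a s _ ih =>
    obtain ⟨r, h1, h2, h3⟩ := ih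
    refine ⟨_, (isCornerFun_rank (u a)).min h1, fun i hi p q => ?_, fun p q => ?_⟩
    · rcases Finset.mem_insert.1 hi with rfl | hi
      · exact min_le_left _ _
      · exact (min_le_right _ _).trans (h2 i hi p q)
    · rcases min_choice (rank (u a) p q) (r p q) with h | h
      · exact Or.inr ⟨a, by simp, h⟩
      · rcases h3 p q with h4 | ⟨i, hi, h4⟩
        · exact Or.inl (h.trans h4)
        · exact Or.inr ⟨i, by simp [hi], h.trans h4⟩

theorem exists_isLUB_permASM {ι : Type*} [Fintype ι] (u : ι → Equiv.Perm (Fin n)) :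
    ∃ A : ASM n, IsLUB (Set.range fun i => permASM (u i)) A := by
  obtain ⟨r, h1, h2, h3⟩ := exists_cornerFun_inf u Finset.univ
  obtain ⟨A, hA⟩ := h1.exists_asm
  refine ⟨A, ?_, ?_⟩
  · rintro _ ⟨i, rfl⟩ p q
    rw [hA, cornerSum_permASM]
    exact h2 i (Finset.mem_univ i) _ _
  · intro B hB i j
    rw [hA]
    rcases h3 (i + 1) (j + 1) with h | ⟨a, -, h⟩
    · rw [h, rank_one]
      have e1 := cornerSum_le_left B i j
      have e2 := cornerSum_le_right B i j
      have := i.2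
      have := j.2
      omega
    · rw [h, ← cornerSum_permASM]
      exact hB ⟨a, rfl⟩ i j

end

/-! ### Supports of prism tableaux -/

section

variable {k : ℕ} {lam : Fin k → YoungDiagram} {d : Fin k → ℕ}

/-- The set of pairs of a label and of an antidiagonal which contains it. -/
def support (T : AllPrism lam d) : Finset (ℕ × ℕ) :=
  Finset.univ.image fun b => (label T b, antidiag d b)

theorem mem_support {T : AllPrism lam d} {c : ℕ × ℕ} :
    c ∈ support T ↔ ∃ b, label T b = c.1 ∧ antidiag d b = c.2 := by
  simp [support, Prod.ext_iff]

theorem label_mem_support (T : AllPrism lam d) (b : ColoredBox lam) :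
    (label T b, antidiag d b) ∈ support T := mem_support.2 ⟨b, rfl, rfl⟩

theorem IsRSSYT.add_lt {μ : YoungDiagram} {d : ℕ} {T : μ.cells → Fin d} (hT : IsRSSYT μ d T)
    (p q : ℕ) (h : (p, q) ∈ μ) : (T ⟨(p, q), h⟩).val + p < d := by
  induction p with
  | zero => exact (T _).2
  | succ p ih =>
    have h' : (p, q) ∈ μ := μ.up_left_mem (Nat.le_succ _) le_rfl h
    have h1 := Fin.lt_def.1 (hT.col_strict ⟨(p, q), h'⟩ ⟨(p + 1, q), h⟩ rfl (Nat.lt_succ_self p))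
    have h2 := ih h'
    omega

theorem support_subset_staircase {n : ℕ} (hn : ∀ i, d i + (lam i).rowLen 0 ≤ n)
    (T : AllPrism lam d) : support T ⊆ staircase n := by
  intro c hc
  obtain ⟨⟨i, ⟨p, q⟩, hb⟩, h1, h2⟩ := mem_support.1 hc
  have h3 : (label T ⟨i, ⟨p, q⟩, hb⟩) + p < d i := (T i).2.add_lt p q hb
  have h4 : q < (lam i).rowLen p := YoungDiagram.mem_iff_lt_rowLen.1 hb
  have h5 := (lam i).rowLen_anti 0 p (Nat.zero_le _)
  have h6 := hn i
  have h7 : antidiag d ⟨i, ⟨p, q⟩, hb⟩ = d i - 1 - p + q := rfl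
  rw [mem_staircase, ← h1, ← h2, h7]
  omega

/-- A label counts once for each antidiagonal containing it, so the exponent of `x_a` is the number
of support pairs over `a`. -/
theorem wt_eq_prod_support (T : AllPrism lam d) : wt T = ∏ c ∈ support T, X c.1 := by
  rw [wt, ← Finset.prod_fiberwise_of_maps_to (s := support T) (t := Finset.univ.image (label T))
    (g := Prod.fst)]
  · refine Finset.prod_congr rfl fun a _ => ?_
    have h1 : (support T).filter (fun c => c.1 = a) =
        ((Finset.univ.filter fun b : ColoredBox lam => label T b = a).image (antidiag d)).image
          fun m => (a, m) := by
      ext ⟨x, m⟩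
      simp only [Finset.mem_filter, mem_support, Finset.mem_image, Finset.mem_univ, true_and,
        Prod.mk.injEq]
      constructor
      · rintro ⟨⟨b, rfl, rfl⟩, rfl⟩
        exact ⟨_, ⟨b, rfl, rfl⟩, rfl, rfl⟩
      · rintro ⟨_, ⟨b, rfl, rfl⟩, rfl, rfl⟩
        exact ⟨⟨b, rfl, rfl⟩, rfl⟩
    rw [h1, Finset.prod_image fun _ _ _ _ h => (Prod.mk.inj h).2]
    exact (Finset.prod_const (X a : MvPolynomial ℕ ℤ)).symm
  · intro c hc
    obtain ⟨b, hb, -⟩ := mem_support.1 hc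
    exact Finset.mem_image.2 ⟨b, Finset.mem_univ _, hb⟩

theorem totalDegree_prod_X (D : Finset (ℕ × ℕ)) :
    (∏ c ∈ D, (X c.1 : MvPolynomial ℕ ℤ)).totalDegree = D.card := by
  have h := MvPolynomial.IsHomogeneous.prod D (fun c => (X c.1 : MvPolynomial ℕ ℤ)) (fun _ => 1)
    fun c _ => MvPolynomial.isHomogeneous_X ℤ c.1
  rw [h.totalDegree (Finset.prod_ne_zero_iff.2 fun c _ => MvPolynomial.X_ne_zero c.1)]
  simp

theorem isMinimalPrism_iff {T : AllPrism lam d} :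
    IsMinimalPrism T ↔ ∀ T' : AllPrism lam d, (support T).card ≤ (support T').card := by
  simp only [IsMinimalPrism, wt_eq_prod_support, totalDegree_prod_X]

/-! ### Supports determine the tableaux without unstable triples. -/

theorem label_injective {T T' : AllPrism lam d} (h : ∀ b, label T b = label T' b) : T = T' := by
  funext i
  refine Subtype.ext (funext fun c => Fin.ext ?_)
  exact h ⟨i, c⟩

/-- Replacing the label of the box `x` of `T` by its larger label in `T'` gives a tableau, if no box
weakly southwest of `x` has this property. -/
theorem exists_replace {T T' : AllPrism lam d} {i : Fin k} {c : (lam i).cells}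
    (hc : (T i).1 c < (T' i).1 c)
    (hmin : ∀ e : (lam i).cells, e.1.1 + e.1.2 < c.1.1 + c.1.2 → (T' i).1 e ≤ (T i).1 e) :
    ∃ S : AllPrism lam d, label S ⟨i, c⟩ = label T' ⟨i, c⟩ ∧
      ∀ b, b ≠ ⟨i, c⟩ → label S b = label T b := by
  classical
  have hS : IsRSSYT (lam i) (d i) (Function.update (T i).1 c ((T' i).1 c)) := by
    constructor
    · intro x x' h h'
      by_cases hx' : x' = c
      · have hx : x ≠ c := by rintro rfl; rw [hx'] at h'; exact lt_irrefl _ h'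
        rw [hx', Function.update_self, Function.update_of_ne hx]
        subst hx'
        exact ((T' i).2.row_weak x x' h h').trans (hmin x (by omega))
      · rw [Function.update_of_ne hx']
        by_cases hx : x = c
        · rw [hx, Function.update_self]
          subst hx
          exact ((T i).2.row_weak x x' h h').trans hc.le
        · rw [Function.update_of_ne hx]
          exact (T i).2.row_weak x x' h h'
    · intro x x' h h'
      by_cases hx' : x' = c
      · have hx : x ≠ c := by rintro rfl; rw [hx'] at h'; exact lt_irrefl _ h'
        rw [hx', Function.update_self, Function.update_of_ne hx]
        subst hx'
        exact ((T' i).2.col_strict x x' h h').trans_le (hmin x (by omega))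
      · rw [Function.update_of_ne hx']
        by_cases hx : x = c
        · rw [hx, Function.update_self]
          subst hx
          exact ((T i).2.col_strict x x' h h').trans hc
        · rw [Function.update_of_ne hx]
          exact (T i).2.col_strict x x' h h'
  refine ⟨Function.update T i ⟨_, hS⟩, ?_, ?_⟩
  · simp [label]
  · rintro ⟨j, e⟩ hb
    by_cases hj : j = i
    · subst hj
      have he : e ≠ c := fun h => hb (by rw [h])
      simp [label, he]
    · simp [label, hj]

/-- At a box where `T'` is larger, chosen with `p + q` minimal, the label of `T` can be raised to
that of `T'` without enlarging the support. Minimality of `T` forces the support to stay the same,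
so the old label survives elsewhere on the antidiagonal, and an unstable triple appears. -/
theorem label_le_of_support_subset {T T' : AllPrism lam d} (hT : T ∈ Prism lam d)
    (h : support T' ⊆ support T) (b : ColoredBox lam) : label T' b ≤ label T b := by
  classical
  simp only [Prism, Finset.mem_filter, Finset.mem_univ, true_and] at hT
  obtain ⟨hmin, hstab⟩ := hT
  by_contra hlt
  obtain ⟨i, c0⟩ := b
  have hc0 : (T i).1 c0 < (T' i).1 c0 := Fin.lt_def.2 (not_le.1 hlt)
  obtain ⟨c, hc, hcmin⟩ := Finset.exists_min_image
    (Finset.univ.filter fun e : (lam i).cells => (T i).1 e < (T' i).1 e)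
    (fun e => e.1.1 + e.1.2) ⟨c0, by simpa using hc0⟩
  simp only [Finset.mem_filter, Finset.mem_univ, true_and] at hc hcmin
  obtain ⟨S, hS1, hS2⟩ := exists_replace hc fun e he => by
    by_contra h'
    exact absurd (hcmin e (not_le.1 h')) (not_le.2 he)
  have hlab : label T ⟨i, c⟩ < label T' ⟨i, c⟩ := Fin.lt_def.1 hc
  have hmem : (label T' ⟨i, c⟩, antidiag d ⟨i, c⟩) ∈ support T := h (label_mem_support T' _)
  have hsub : support S ⊆ support T := by
    intro x hx
    obtain ⟨b, h1, h2⟩ := mem_support.1 hx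
    have hx' : x = (label S b, antidiag d b) := by rw [h1, h2]
    rw [hx']
    by_cases hb : b = ⟨i, c⟩
    · rw [hb, hS1]
      exact hmem
    · rw [hS2 b hb]
      exact label_mem_support T b
  have heq := Finset.eq_of_subset_of_card_le hsub (isMinimalPrism_iff.1 hmin S)
  -- In the triple, `y` carries the old label after the replacement, and `z` carries the new label
  -- already in `T`.
  obtain ⟨y, hy1, hy2⟩ := mem_support.1 (heq ▸ label_mem_support T ⟨i, c⟩)
  obtain ⟨z, hz1, hz2⟩ := mem_support.1 hmem
  have hyc : y ≠ ⟨i, c⟩ := by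
    rintro rfl
    rw [hS1] at hy1
    exact hlab.ne' hy1
  rw [hS2 y hyc] at hy1
  refine hstab ⟨⟨i, c⟩, y, z, hyc.symm, hy2.symm, hz2.symm, hy1.symm, ?_, S, ?_, hS2⟩
  · rw [hz1]; exact hlab
  · rw [hS1, hz1]

theorem eq_of_support_eq {T T' : AllPrism lam d} (hT : T ∈ Prism lam d) (hT' : T' ∈ Prism lam d)
    (h : support T = support T') : T = T' :=
  label_injective fun b => le_antisymm (label_le_of_support_subset hT' h.le b)
    (label_le_of_support_subset hT h.ge b)

/-- Take a tableau supported in `D` with the largest sum of labels: the replacement in an unstable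
triple would keep the support in `D` and increase this sum. -/
theorem exists_mem_Prism_support_eq {D : Finset (ℕ × ℕ)} {T₀ : AllPrism lam d}
    (h₀ : support T₀ ⊆ D) (hD : ∀ T : AllPrism lam d, D.card ≤ (support T).card) :
    ∃ T ∈ Prism lam d, support T = D := by
  classical
  obtain ⟨T, hT, hmax⟩ := Finset.exists_max_image
    (Finset.univ.filter fun T : AllPrism lam d => support T ⊆ D)
    (fun T => ∑ b, label T b) ⟨T₀, by simpa using h₀⟩
  simp only [Finset.mem_filter, Finset.mem_univ, true_and] at hT hmax
  have hTD := Finset.eq_of_subset_of_card_le hT (hD T)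
  refine ⟨T, ?_, hTD⟩
  simp only [Prism, Finset.mem_filter, Finset.mem_univ, true_and]
  refine ⟨isMinimalPrism_iff.2 fun T' => hTD ▸ hD T', ?_⟩
  rintro ⟨x, y, z, -, -, hxz, -, hlt, T', h1, h2⟩
  have hle : ∀ b, label T b ≤ label T' b := fun b => by
    by_cases hb : b = x
    · rw [hb, h1]; exact hlt.le
    · rw [h2 b hb]
  refine absurd (hmax T' fun c hc => ?_) (not_le.2 (Finset.sum_lt_sum (fun b _ => hle b)
    ⟨x, Finset.mem_univ _, by rw [h1]; exact hlt⟩))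
  refine hT ?_
  obtain ⟨b, hb1, hb2⟩ := mem_support.1 hc
  by_cases hb : b = x
  · exact mem_support.2 ⟨z, by rw [← hb1, hb, h1], by rw [← hb2, hb, hxz]⟩
  · exact mem_support.2 ⟨b, by rw [← hb1, h2 b hb], hb2⟩

/-! ### The main theorem -/

section

variable {n : ℕ} {A : ASM n}

theorem deg_le_length {w : Equiv.Perm (Fin n)} (h : A ≤ permASM w) : deg A ≤ length w :=
  Nat.sInf_le ⟨w, h, rfl⟩

/-- Minimality in the Bruhat order is automatic for an element of length `deg A`, since below it
there is nothing of at least the same length. -/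
theorem mem_minPerm {w : Equiv.Perm (Fin n)} :
    w ∈ minPerm A ↔ A ≤ permASM w ∧ length w = deg A := by
  simp only [minPerm, Finset.mem_filter, Finset.mem_univ, true_and]
  refine ⟨fun h => ⟨h.1.1, h.2⟩, fun h => ⟨⟨h.1, fun v hv hvw => ?_⟩, h.2⟩⟩
  exact eq_of_le_of_length_le hvw (h.2.trans_le (deg_le_length hv))

open Classical in
/-- The subsets of the staircase of size `deg A` with a Demazure product above `A`. -/
noncomputable def minimalPipeDreams (A : ASM n) : Finset (Finset (ℕ × ℕ)) :=
  (staircase n).powerset.filter fun D =>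
    A ≤ permASM (demazureProd n (cells n n) D) ∧ D.card = deg A

theorem mem_minimalPipeDreams {D : Finset (ℕ × ℕ)} : D ∈ minimalPipeDreams A ↔
    D ⊆ staircase n ∧ A ≤ permASM (demazureProd n (cells n n) D) ∧ D.card = deg A := by
  simp [minimalPipeDreams]

theorem length_demazureProd_of_mem_minimalPipeDreams {D : Finset (ℕ × ℕ)}
    (h : D ∈ minimalPipeDreams A) : length (demazureProd n (cells n n) D) = deg A := by
  obtain ⟨h1, h2, h3⟩ := mem_minimalPipeDreams.1 h
  exact le_antisymm (h3 ▸ length_demazureProd_cells_le h1) (deg_le_length h2)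

theorem sum_schubert_minPerm :
    ∑ w ∈ minPerm A, schubert w = ∑ D ∈ minimalPipeDreams A, ∏ c ∈ D, X c.1 := by
  classical
  rw [← Finset.sum_fiberwise_of_maps_to (t := minPerm A) (g := demazureProd n (cells n n))
    fun D hD => mem_minPerm.2 ⟨(mem_minimalPipeDreams.1 hD).2.1,
      length_demazureProd_of_mem_minimalPipeDreams hD⟩]
  refine Finset.sum_congr rfl fun w hw => ?_
  obtain ⟨h1, h2⟩ := mem_minPerm.1 hw
  rw [schubert_eq_sum]
  refine Finset.sum_congr ?_ fun _ _ => rfl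
  ext D
  rw [mem_reducedPipeDreams, Finset.mem_filter, mem_minimalPipeDreams]
  constructor
  · rintro ⟨h3, rfl, h4⟩
    exact ⟨⟨h3, h1, h4.trans h2⟩, rfl⟩
  · rintro ⟨⟨h3, -, h4⟩, rfl⟩
    exact ⟨h3, rfl, h4.trans h2.symm⟩

/-- By `hA`, the least size of a support is `deg A`: a support has at least that size by the length
bound, and a reduced pipe dream of a shortest `w` above `A` contains one. Taking supports is then a
bijection onto `minimalPipeDreams A`. -/
theorem asmPolynomial_eq_sum
    (hA : ∀ D ⊆ staircase n, A ≤ permASM (demazureProd n (cells n n) D) ↔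
      ∃ T : AllPrism lam d, support T ⊆ D)
    (hsupp : ∀ T : AllPrism lam d, support T ⊆ staircase n)
    (hne : ∃ w, A ≤ permASM w) :
    asmPolynomial lam d = ∑ D ∈ minimalPipeDreams A, ∏ c ∈ D, X c.1 := by
  have lower : ∀ T : AllPrism lam d, deg A ≤ (support T).card := fun T =>
    (deg_le_length ((hA _ (hsupp T)).2 ⟨T, subset_rfl⟩)).trans
      (length_demazureProd_cells_le (hsupp T))
  obtain ⟨w, hw, hwdeg⟩ : ∃ w : Equiv.Perm (Fin n), A ≤ permASM w ∧ length w = deg A :=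
    Nat.sInf_mem (s := {m | ∃ w : Equiv.Perm (Fin n), A ≤ permASM w ∧ length w = m})
      (hne.imp' length fun w h => ⟨w, h, rfl⟩)
  obtain ⟨D₀, hD₀⟩ := reducedPipeDreams_nonempty w
  obtain ⟨h1, h2, h3⟩ := mem_reducedPipeDreams.1 hD₀
  obtain ⟨T₀, hT₀⟩ := (hA D₀ h1).1 (by rwa [h2])
  have upper : (support T₀).card ≤ deg A := by
    rw [← hwdeg, ← h3]
    exact Finset.card_le_card hT₀
  refine Finset.sum_nbij support (fun T hT => ?_) (fun T hT T' hT' h => eq_of_support_eq hT hT' h)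
    (fun D hD => ?_) (fun T _ => wt_eq_prod_support T)
  · classical
    simp only [Prism, Finset.mem_filter, Finset.mem_univ, true_and] at hT
    exact mem_minimalPipeDreams.2 ⟨hsupp T, (hA _ (hsupp T)).2 ⟨T, subset_rfl⟩,
      le_antisymm ((isMinimalPrism_iff.1 hT.1 T₀).trans upper) (lower T)⟩
  · obtain ⟨h4, h5, h6⟩ := mem_minimalPipeDreams.1 hD
    obtain ⟨T, hT⟩ := (hA D h4).1 h5
    obtain ⟨S, hS, rfl⟩ := exists_mem_Prism_support_eq hT fun T => h6 ▸ lower T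
    exact ⟨S, hS, rfl⟩

end

end

end PrismASM

theorem theorem1p1 {k : ℕ} (lam : Fin k → YoungDiagram) (d : Fin k → ℕ)
    (hpos : ∀ i, 0 < d i) (hlen : ∀ i, (lam i).colLen 0 ≤ d i)
    (n : ℕ) (hn : ∀ i, d i + (lam i).rowLen 0 ≤ n) :
    ∃ A : PrismASM.ASM n,
      IsLUB (Set.range fun i : Fin k =>
        PrismASM.permASM (PrismASM.grassmannian n (lam i) (d i) (hlen i) (hn i))) A ∧
      PrismASM.asmPolynomial lam d = ∑ w ∈ PrismASM.minPerm A, PrismASM.schubert w := by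
  open PrismASM in
  obtain ⟨A, hA⟩ := exists_isLUB_permASM fun i => grassmannian n (lam i) (d i) (hlen i) (hn i)
  have hle : ∀ w : Equiv.Perm (Fin n), A ≤ permASM w ↔
      ∀ i, permASM (grassmannian n (lam i) (d i) (hlen i) (hn i)) ≤ permASM w := fun w => by
    rw [isLUB_le_iff hA, mem_upperBounds, Set.forall_mem_range]
  refine ⟨A, hA, ?_⟩
  rw [sum_schubert_minPerm]
  refine asmPolynomial_eq_sum (fun D hD => ?_) (support_subset_staircase hn)
    ⟨_, (hle _).2 fun i => le_demazureProd_staircase _⟩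
  rw [hle]
  -- The colors decouple: the entries of a prism tableau in different colors are unrelated, so one
  -- tableau per color supported in `D` is the same as one prism tableau supported in `D`.
  simp only [grassmannian_le_demazureProd_iff _ _ _ _ hD]
  constructor
  · intro h
    choose T hT using h
    refine ⟨T, fun c hc => ?_⟩
    obtain ⟨⟨i, b⟩, h1, h2⟩ := mem_support.1 hc
    have h3 : c = (label T ⟨i, b⟩, antidiag d ⟨i, b⟩) := by rw [h1, h2]
    rw [h3]
    exact hT i b
  · rintro ⟨T, hT⟩ i
    exact ⟨T i, fun b => hT (label_mem_support T ⟨i, b⟩)⟩
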